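/- Let $n\ge 1$, let $\mathbb H^{n,1}=\mathbb H^{n+1}$ (right vector space) with the Hermitian form $\langle z,w\rangle=w^*Hz=\bar w_{n+1}z_1+\bar w_2z_2+\dots+\bar w_nz_n+\bar w_1z_{n+1}$, and $\mathrm{Sp}(n,1)=\{A: A^*HA=H\}$. It acts on $\overline{\mathbf H}=\mathbf H^n_{\mathbb H}\cup\partial\mathbf H^n_{\mathbb H}$, the set of lines $v\mathbb H$ with $\langle v,v\rangle\le 0$, $v\neq0$ (negative lines and null lines). $A$ is semisimple if $\mathbb H^{n+1}$ has a basis of right eigenvectors ($Av=vq$); then $A$ is elliptic (fixes a point of $\mathbf H^n_{\mathbb H}$) or hyperbolic (fixes exactly two points of $\partial\mathbf H^n_{\mathbb H}$). **Notions.** (1) *Real trace.* Write $A=A_1+\mathbf jA_2$ with complex $A_1,A_2$, and $A_{\mathbb C}=\begin{pmatrix}A_1&-\overline{A_2}\\A_2&\overline{A_1}\end{pmatrix}$; $\mathrm{tr}_{\mathbb R}(A)$ is the list of coefficients of the characteristic polynomial of $A_{\mathbb C}$ (of degree $2n+2$; they are real). (2) *Eigensets.* For $\mu\in\mathbb C$,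 $S_\mu(A)=\{x: Ax=x\mu\}$, and $V_{[\mu]}(A)=S_\mu(A)\mathbb H$ is the eigenspace of the similarity class $[\mu]$. Classes are represented by $\mu$ with $\operatorname{Im}\mu\ge0$. (3) *Frames and associated points.* A hyperbolic frame is a basis $(\mathbf a,\mathbf r,\mathbf x_1,\dots,\mathbf x_{n-1})$ with $\mathbf a,\mathbf r$ null, $\langle \mathbf a,\mathbf r\rangle=1$, $\langle \mathbf x_l,\mathbf x_m\rangle=\delta_{lm}$ and $\mathbf x_l\perp \mathbf a,\mathbf r$; its associated points are the points of $\partial\mathbf H^n_{\mathbb H}$ spanned by $\mathbf a$, $\mathbf r$, $(\mathbf a-\mathbf r)/\sqrt2+\mathbf x_l$. An elliptic frame is an orthogonal basis $(\mathbf x_1,\dots,\mathbf x_{n+1})$ with $\langle \mathbf x_1,\mathbf x_1\rangle=-1$, $\langle \mathbf x_j,\mathbf x_j\rangle=1$ for $j\ge2$; its associated points are the points of $\mathbf H^n_{\mathbb H}$ spanned by $\mathbf x_1$, $\sqrt2\,\mathbf x_1+\mathbf x_j$. An eigenframe of $A$ is a frame of the kind of $A$ whose vectors lie in the eigenspaces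 of $A$, ordered so that: for hyperbolic $A$, $\mathbf a,\mathbf r$ belong to the classes of $re^{i\theta},r^{-1}e^{i\theta}$ with $r>1$, and the $\mathbf x_l$ to unit eigenvalues of increasing argument in $[0,\pi]$; for elliptic $A$, $\mathbf x_1$ is negative and $\mathbf x_2,\dots,\mathbf x_{n+1}$ belong to eigenvalues of increasing argument in $[0,\pi]$. The multiplicity of $A$ is the list of the multiplicities of its eigenvalue classes in increasing order (of modulus, then of argument) and, for elliptic $A$, the place of the negative class in this list. A pair of frames consists of two frames, each hyperbolic or elliptic; if both are hyperbolic, the points $a,r$ of the first are required to be different from the points $a',r'$ of the second, and $\langle \mathbf r,\mathbf a'\rangle=1$. (4) *Canonical orbits.* Let $\mathrm M$ be the set of $\mathrm{Sp}(n,1)$-congruence classes of ordered $(2n+2)$-tuples of (not necessarily distinct) points of $\overline{\mathbf H}$. Given kinds and multiplicities, the group of changes of frames consists of the pairs of block-diagonal matrices preserving the Gram matrices of the two frames and the normalization (factors $\mathbb H^*\times\prod \mathrm{Sp}(m_i)$ for a hyperbolic frame; $\mathrm{Sp}(m_1-1,1)\times\prod_{i\ge2}\mathrm{Sp}(m_i)$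 for an elliptic one, $m_1$ being the multiplicity of the negative class; the two factors $\mathbb H^*$ coincide if both frames are hyperbolic). $\mathcal{QL}_n$ is the disjoint union, over all kinds and multiplicities, of the sets of orbits $\{[p(E\cdot g)]: g\}\subset \mathrm M$, where $p(E)$ is the tuple of associated points of a pair of frames $E$. The canonical orbit of $(A,B)$ is the set of the classes $[p(E)]$ of all eigenframes $E$ of $(A,B)$ (pairs of frames formed by eigenframes of $A$ and of $B$), together with the kinds and multiplicities of $A$ and $B$. (5) *Points on the eigenvalue Grassmannians.* For a non-real class $[\mu]$, an eigenframe of $A$ identifies $V_{[\mu]}(A)$ with $\mathbb H^m$, $m=\dim_{\mathbb H}V_{[\mu]}(A)$, and $S_\mu(A)$ with a complex $m$-dimensional subspace of $\mathbb H^m\cong\mathbb C^{2m}$, a point of $G_{m,2m}$. To compare such points for different pairs, fix for each $O\in\mathcal{QL}_n$ a reference pair of frames $\rho(O)$ with $[p(\rho(O))]\in O$, of the kinds of $O$. The points on the eigenvalue Grassmannians of $(A,B)$ are the families of points of the $G_{m,2m}$ given by the eigensets $S_\mu(A)$, $S_\mu(B)$, for all non-real eigenvalue classes, in the coordinates of an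 eigenframe $E$ of $(A,B)$ of the form $E=C\rho(O)$ with $C\in\mathrm{Sp}(n,1)$ and $O$ the canonical orbit of $(A,B)$. $\mathcal G_\rho(A,B)$ denotes the set of all these families. **Theorem.** Let $A,B,A',B'\in\mathrm{Sp}(n,1)$ be semisimple (each hyperbolic or elliptic, so hyperbolic, elliptic and mixed pairs are all included), such that neither $A,B$ nor $A',B'$ have a common fixed point in $\overline{\mathbf H}$, and let $\rho$ be any choice of reference pairs of frames. Then 1. the canonical orbit of $(A,B)$ is a point of $\mathcal{QL}_n$, and $\mathcal G_\rho(A,B)\ne\emptyset$; 2. if $(A,B)$ and $(A',B')$ are conjugate in $\mathrm{Sp}(n,1)$, then $\mathrm{tr}_{\mathbb R}(A)=\mathrm{tr}_{\mathbb R}(A')$, $\mathrm{tr}_{\mathbb R}(B)=\mathrm{tr}_{\mathbb R}(B')$, their canonical orbits are equal, and $\mathcal G_\rho(A,B)=\mathcal G_\rho(A',B')$; 3. conversely, if $\mathrm{tr}_{\mathbb R}(A)=\mathrm{tr}_{\mathbb R}(A')$, $\mathrm{tr}_{\mathbb R}(B)=\mathrm{tr}_{\mathbb R}(B')$, the canonical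 orbits of $(A,B)$ and $(A',B')$ are equal, and the two pairs have a common family of points on the eigenvalue Grassmannians, that is, $\mathcal G_\rho(A,B)\cap\mathcal G_\rho(A',B')\ne\emptyset$, then there is $C\in\mathrm{Sp}(n,1)$ with $CAC^{-1}=A'$ and $CBC^{-1}=B'$. -/

import Mathlib

noncomputable section

namespace QuatHyp

open Quaternion Matrix MulOpposite
open scoped LinearAlgebra.Projectivization ComplexConjugate

/-! ### The quaternionic Hermitian space of signature `(n, 1)` and its isometry group -/

/-- Column vectors with `n + 1` quaternionic entries. Scalars act on the right, so this is a vector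
space over the opposite ring of the quaternions. -/
abbrev Vec (n : ℕ) : Type := Fin (n + 1) → ℍ[ℝ]

/-- Square quaternionic matrices of size `n + 1`; they act on columns from the left. -/
abbrev Mat (n : ℕ) : Type := Matrix (Fin (n + 1)) (Fin (n + 1)) ℍ[ℝ]

/-- The matrix of the Hermitian form of the Siegel model: the first and the last basis vectors are
null and pair to `1`, the other ones are orthonormal. -/
def formMatrix (n : ℕ) : Mat n := Matrix.of fun i j =>
  if (i = 0 ∧ j = Fin.last n) ∨ (i = Fin.last n ∧ j = 0) ∨
    (i = j ∧ i ≠ 0 ∧ i ≠ Fin.last n) then 1 else 0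

/-- The Hermitian form `⟨z, w⟩ = w* H z`. -/
def herm {n : ℕ} (z w : Vec n) : ℍ[ℝ] := star w ⬝ᵥ (formMatrix n *ᵥ z)

/-- The group `Sp(n, 1)` of the invertible matrices `A` with `A* H A = H`. -/
def Sp (n : ℕ) : Subgroup (Mat n)ˣ where
  carrier := {A | (A : Mat n)ᴴ * formMatrix n * (A : Mat n) = formMatrix n}
  one_mem' := by simp
  mul_mem' := by
    intro A B hA hB
    simp only [Set.mem_ofPred_eq, Units.val_mul, conjTranspose_mul] at *
    calc _ = (B : Mat n)ᴴ * ((A : Mat n)ᴴ * formMatrix n * (A : Mat n)) * (B : Mat n) := by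
            simp only [mul_assoc]
      _ = _ := by rw [hA, hB]
  inv_mem' := by
    intro A hA
    simp only [Set.mem_ofPred_eq] at *
    have h1 : (A : Mat n) * ((A⁻¹ : (Mat n)ˣ) : Mat n) = 1 := A.mul_inv
    have h2 : ((A⁻¹ : (Mat n)ˣ) : Mat n)ᴴ * (A : Mat n)ᴴ = 1 := by
      rw [← conjTranspose_mul, h1, conjTranspose_one]
    calc ((A⁻¹ : (Mat n)ˣ) : Mat n)ᴴ * formMatrix n * ((A⁻¹ : (Mat n)ˣ) : Mat n)
        = ((A⁻¹ : (Mat n)ˣ) : Mat n)ᴴ * ((A : Mat n)ᴴ * formMatrix n * (A : Mat n))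
            * ((A⁻¹ : (Mat n)ˣ) : Mat n) := by rw [hA]
      _ = (((A⁻¹ : (Mat n)ˣ) : Mat n)ᴴ * (A : Mat n)ᴴ) * formMatrix n
            * ((A : Mat n) * ((A⁻¹ : (Mat n)ˣ) : Mat n)) := by simp only [mul_assoc]
      _ = formMatrix n := by rw [h1, h2]; simp

/-- The underlying matrix of an element of `Sp(n, 1)`. -/
def mat {n : ℕ} (A : Sp n) : Mat n := ((A : (Mat n)ˣ) : Mat n)

/-- `Sp(n, 1)` acts on column vectors by matrix multiplication. -/
instance instActionVec (n : ℕ) : DistribMulAction (Sp n) (Vec n) where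
  smul A v := mat A *ᵥ v
  one_smul v := show mat 1 *ᵥ v = v by simp [mat]
  mul_smul A B v := show mat (A * B) *ᵥ v = mat A *ᵥ (mat B *ᵥ v) by
    simp [mat, mulVec_mulVec]
  smul_zero A := show mat A *ᵥ 0 = 0 by simp
  smul_add A v w := show mat A *ᵥ (v + w) = mat A *ᵥ v + mat A *ᵥ w from mulVec_add _ _ _

theorem smul_vec {n : ℕ} (A : Sp n) (v : Vec n) : A • v = mat A *ᵥ v := rfl

instance instCommVec (n : ℕ) : SMulCommClass (Sp n) ℍ[ℝ]ᵐᵒᵖ (Vec n) where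
  smul_comm A q v := by simp only [smul_vec, mulVec_smul]

theorem herm_smul_smul {n : ℕ} (A : Sp n) (z w : Vec n) : herm (A • z) (A • w) = herm z w := by
  have hA : (mat A)ᴴ * formMatrix n * mat A = formMatrix n := A.2
  simp only [herm, smul_vec, star_mulVec]
  rw [← dotProduct_mulVec, mulVec_mulVec, mulVec_mulVec, hA]

theorem herm_add_left {n : ℕ} (x y w : Vec n) : herm (x + y) w = herm x w + herm y w := by
  simp [herm, mulVec_add]

theorem herm_add_right {n : ℕ} (x y w : Vec n) : herm w (x + y) = herm w x + herm w y := by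
  simp [herm, add_dotProduct]

theorem herm_sub_left {n : ℕ} (x y w : Vec n) : herm (x - y) w = herm x w - herm y w := by
  simp [herm, mulVec_sub]

theorem herm_sub_right {n : ℕ} (x y w : Vec n) : herm w (x - y) = herm w x - herm w y := by
  simp [herm, sub_dotProduct]

theorem herm_smul_left {n : ℕ} (r : ℝ) (x w : Vec n) : herm (r • x) w = r • herm x w := by
  simp [herm, mulVec_smul]

theorem herm_smul_right {n : ℕ} (r : ℝ) (x w : Vec n) : herm w (r • x) = r • herm w x := by
  have h : star (r • x) = r • star x := by
    ext1 i
    ext <;> simp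
  simp [herm, h]

/-! ### Quaternionic hyperbolic space -/

/-- The quaternionic projective space of the lines `v ℍ`. -/
abbrev HP (n : ℕ) : Type := ℙ ℍ[ℝ]ᵐᵒᵖ (Vec n)

/-- Quaternionic hyperbolic space: the lines spanned by negative vectors. -/
def hyperbolicSpace (n : ℕ) : Set (HP n) :=
  {p | ∃ (v : Vec n) (hv : v ≠ 0), p = Projectivization.mk ℍ[ℝ]ᵐᵒᵖ v hv ∧ (herm v v).re < 0}

/-- The ideal boundary: the lines spanned by null vectors. -/
def boundary (n : ℕ) : Set (HP n) :=
  {p | ∃ (v : Vec n) (hv : v ≠ 0), p = Projectivization.mk ℍ[ℝ]ᵐᵒᵖ v hv ∧ (herm v v).re = 0}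

/-- Hyperbolic space together with its ideal boundary. -/
def ClosedHyp (n : ℕ) : Type := {p : HP n // p ∈ hyperbolicSpace n ∪ boundary n}

theorem smul_mem_closed {n : ℕ} (A : Sp n) {p : HP n} (hp : p ∈ hyperbolicSpace n ∪ boundary n) :
    A • p ∈ hyperbolicSpace n ∪ boundary n := by
  rcases hp with ⟨v, hv, rfl, h⟩ | ⟨v, hv, rfl, h⟩
  · left
    exact ⟨A • v, (smul_ne_zero_iff_ne A).mpr hv, rfl, by rwa [herm_smul_smul]⟩
  · right
    exact ⟨A • v, (smul_ne_zero_iff_ne A).mpr hv, rfl, by rwa [herm_smul_smul]⟩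

/-- `Sp(n, 1)` acts on the closure of hyperbolic space. -/
instance instActionClosed (n : ℕ) : MulAction (Sp n) (ClosedHyp n) where
  smul A p := ⟨A • p.1, smul_mem_closed A p.2⟩
  one_smul p := Subtype.ext (one_smul (Sp n) p.1)
  mul_smul A B p := Subtype.ext (mul_smul A B p.1)

/-- Elliptic: some point of hyperbolic space is fixed. -/
def IsElliptic {n : ℕ} (A : Sp n) : Prop := ∃ p ∈ hyperbolicSpace n, A • p = p

/-- Hyperbolic: exactly two points of the ideal boundary are fixed. -/
def IsHyperbolic {n : ℕ} (A : Sp n) : Prop := {p : HP n | p ∈ boundary n ∧ A • p = p}.ncard = 2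

/-- Semisimple: there is a basis of (right) eigenvectors, `A v = v q`. -/
def IsSemisimple {n : ℕ} (A : Sp n) : Prop :=
  ∃ v : Module.Basis (Fin (n + 1)) ℍ[ℝ]ᵐᵒᵖ (Vec n), ∀ i, ∃ q : ℍ[ℝ], mat A *ᵥ v i = op q • v i

/-- `A` and `B` fix a common point of the closure of hyperbolic space. -/
def HaveCommonFixedPoint {n : ℕ} (A B : Sp n) : Prop := ∃ p : ClosedHyp n, A • p = p ∧ B • p = p

/-! ### Real traces -/

/-- The matrix `A₁` in the decomposition `A = A₁ + j A₂` with complex `A₁`, `A₂`. -/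
def complexPart {n : ℕ} (A : Mat n) : Matrix (Fin (n + 1)) (Fin (n + 1)) ℂ :=
  A.map fun q => ⟨q.re, q.imI⟩

/-- The matrix `A₂` in the decomposition `A = A₁ + j A₂`; recall that `j i = - k`. -/
def jPart {n : ℕ} (A : Mat n) : Matrix (Fin (n + 1)) (Fin (n + 1)) ℂ :=
  A.map fun q => ⟨q.imJ, -q.imK⟩

/-- The complex representation of a quaternionic matrix, of size `2n + 2`. -/
def complexRep {n : ℕ} (A : Mat n) :
    Matrix (Fin (n + 1) ⊕ Fin (n + 1)) (Fin (n + 1) ⊕ Fin (n + 1)) ℂ :=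
  Matrix.fromBlocks (complexPart A) (-(jPart A).map conj) (jPart A) ((complexPart A).map conj)

/-- The real trace: the coefficients of the characteristic polynomial of the complex
representation, a monic polynomial of degree `2n + 2` (they are real numbers). -/
def realTrace {n : ℕ} (A : Sp n) : Fin (2 * n + 2) → ℂ :=
  fun j => (complexRep (mat A)).charpoly.coeff j

/-! ### Eigensets and eigenspaces -/

/-- The eigenset `{x | A x = x μ}` of a complex number `μ`. -/
def eigenset {n : ℕ} (A : Sp n) (μ : ℂ) : Submodule ℝ (Vec n) where
  carrier := {x | mat A *ᵥ x = op (μ : ℍ[ℝ]) • x}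
  zero_mem' := by simp
  add_mem' := by
    intro x y hx hy
    simp only [Set.mem_ofPred_eq] at *
    rw [mulVec_add, hx, hy, smul_add]
  smul_mem' := by
    intro r x hx
    simp only [Set.mem_ofPred_eq] at *
    rw [mulVec_smul, hx, smul_comm]

/-- The eigenspace of the similarity class `[μ]`: the quaternionic span of the eigenset. -/
def eigenspace {n : ℕ} (A : Sp n) (μ : ℂ) : Submodule ℍ[ℝ]ᵐᵒᵖ (Vec n) :=
  Submodule.span ℍ[ℝ]ᵐᵒᵖ (eigenset A μ : Set (Vec n))

/-! ### Orthonormal frames and associated points -/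

/-- The two kinds of semisimple elements, and of orthonormal frames. -/
inductive Kind : Type
  | hyperbolic : Kind
  | elliptic : Kind

/-- `A` is of the given kind. -/
def Kind.Matches {n : ℕ} : Kind → Sp n → Prop
  | .hyperbolic, A => IsHyperbolic A
  | .elliptic, A => IsElliptic A

/-- The Gram matrix of an orthonormal frame. Hyperbolic frames `(a, r, x₁, …, x_{n-1})` have null
`a`, `r` with `⟨a, r⟩ = 1`, and the orthonormal positive `x_l` are orthogonal to both. Elliptic
frames `(x₁, …, x_{n+1})` are orthogonal with `⟨x₁, x₁⟩ = -1` and the others of norm `1`. -/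
def gramMatrix (n : ℕ) : Kind → Mat n
  | .hyperbolic => Matrix.of fun i j =>
      if (i = 0 ∧ j = 1) ∨ (i = 1 ∧ j = 0) ∨ (i = j ∧ i ≠ 0 ∧ i ≠ 1) then 1 else 0
  | .elliptic => Matrix.of fun i j => if i = j then (if i = 0 then -1 else 1) else 0

/-- `e` is an orthonormal frame of the given kind. -/
def IsFrame {n : ℕ} (k : Kind) (e : Fin (n + 1) → Vec n) : Prop :=
  ∀ i j, herm (e i) (e j) = gramMatrix n k i j

/-- Lifts of the associated points of a frame: `a`, `r` and `(a - r)/√2 + x_l` for a hyperbolic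
frame, `x₁` and `√2 x₁ + x_j` for an elliptic one. -/
def assocVec {n : ℕ} : Kind → (Fin (n + 1) → Vec n) → Fin (n + 1) → Vec n
  | .hyperbolic, e, l => if l = 0 then e 0 else if l = 1 then e 1 else
      (√2 : ℝ)⁻¹ • (e 0 - e 1) + e l
  | .elliptic, e, l => if l = 0 then e 0 else (√2 : ℝ) • e 0 + e l

theorem zero_ne_one_fin (n : ℕ) [NeZero n] : (0 : Fin (n + 1)) ≠ 1 := by
  obtain ⟨m, rfl⟩ := Nat.exists_eq_succ_of_ne_zero (NeZero.ne n)
  simp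

theorem assocVec_norm_hyperbolic {n : ℕ} [NeZero n] {e : Fin (n + 1) → Vec n}
    (he : IsFrame .hyperbolic e) (l : Fin (n + 1)) :
    herm (assocVec .hyperbolic e l) (assocVec .hyperbolic e l) = 0 := by
  have h01 := zero_ne_one_fin n
  have h10 := h01.symm
  by_cases h0 : l = 0
  · simp [assocVec, h0, he 0 0, gramMatrix, h01]
  by_cases h1 : l = 1
  · simp [assocVec, h1, h10, he 1 1, gramMatrix]
  have h0' : (0 : Fin (n + 1)) ≠ l := fun h => h0 h.symm
  have h1' : (1 : Fin (n + 1)) ≠ l := fun h => h1 h.symm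
  have hs : (√2 : ℝ)⁻¹ * (√2 : ℝ)⁻¹ = 2⁻¹ := by
    rw [← mul_inv, Real.mul_self_sqrt (by norm_num)]
  simp only [assocVec, h0, h1, if_false, herm_add_left, herm_add_right, herm_sub_left,
    herm_sub_right, herm_smul_left, herm_smul_right, he _ _]
  simp [gramMatrix, h0, h1, h01, h0', h1']
  ext <;> simp
  linarith

theorem assocVec_norm_elliptic {n : ℕ} {e : Fin (n + 1) → Vec n}
    (he : IsFrame .elliptic e) (l : Fin (n + 1)) :
    herm (assocVec .elliptic e l) (assocVec .elliptic e l) = -1 := by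
  by_cases h0 : l = 0
  · simp [assocVec, h0, he 0 0, gramMatrix]
  have h0' : (0 : Fin (n + 1)) ≠ l := fun h => h0 h.symm
  have hs : (√2 : ℝ) * (√2 : ℝ) = 2 := Real.mul_self_sqrt (by norm_num)
  simp only [assocVec, h0, if_false, herm_add_left, herm_add_right, herm_smul_left,
    herm_smul_right, he _ _]
  simp [gramMatrix, h0, h0', smul_smul, hs]
  ext <;> norm_num

theorem assocVec_ne_zero {n : ℕ} [NeZero n] {k : Kind} {e : Fin (n + 1) → Vec n}
    (he : IsFrame k e) (l : Fin (n + 1)) : assocVec k e l ≠ 0 := by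
  intro hz
  cases k with
  | elliptic =>
    have h := assocVec_norm_elliptic he l
    rw [hz] at h
    simp [herm] at h
  | hyperbolic =>
    have h01 := zero_ne_one_fin n
    have h10 := h01.symm
    by_cases h0 : l = 0
    · have h := he 0 1
      simp only [assocVec, h0, if_true] at hz
      rw [hz] at h
      simp [herm, gramMatrix] at h
    by_cases h1 : l = 1
    · have h := he 1 0
      simp only [assocVec, h1, h10, if_true, if_false] at hz
      rw [hz] at h
      simp [herm, gramMatrix] at h
    have h : herm (assocVec .hyperbolic e l) (e 0) = 0 := by rw [hz]; simp [herm]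
    simp only [assocVec, h0, h1, if_false, herm_add_left, herm_sub_left, herm_smul_left,
      he _ _] at h
    simp [gramMatrix, h0, h1, h01] at h

/-- The associated points of a frame: boundary points for a hyperbolic frame, points of hyperbolic
space for an elliptic frame. -/
def assocPoint {n : ℕ} [NeZero n] {k : Kind} {e : Fin (n + 1) → Vec n} (he : IsFrame k e)
    (l : Fin (n + 1)) : ClosedHyp n :=
  ⟨Projectivization.mk ℍ[ℝ]ᵐᵒᵖ (assocVec k e l) (assocVec_ne_zero he l), by
    cases k with
    | hyperbolic =>
      exact Or.inr ⟨_, assocVec_ne_zero he l, rfl, by simp [assocVec_norm_hyperbolic he l]⟩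
    | elliptic =>
      exact Or.inl ⟨_, assocVec_ne_zero he l, rfl, by simp [assocVec_norm_elliptic he l]⟩⟩

/-- A pair of orthonormal frames of `ℍ^{n,1}`. If both are hyperbolic, `(a, r, …)` and
`(a', r', …)`, then the points `a`, `r` are different from `a'`, `r'`, and the two frames are
normalized by `⟨r, a'⟩ = 1`. -/
structure FramePair (n : ℕ) where
  /-- the kind of the first frame -/
  kind₁ : Kind
  /-- the kind of the second frame -/
  kind₂ : Kind
  /-- the first frame -/
  frame₁ : Fin (n + 1) → Vec n
  /-- the second frame -/
  frame₂ : Fin (n + 1) → Vec n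
  isFrame₁ : IsFrame kind₁ frame₁
  isFrame₂ : IsFrame kind₂ frame₂
  disjoint : kind₁ = .hyperbolic → kind₂ = .hyperbolic →
    ∀ i j : Fin (n + 1), (i = 0 ∨ i = 1) → (j = 0 ∨ j = 1) →
      ∀ q : ℍ[ℝ], frame₁ i ≠ op q • frame₂ j
  normalized : kind₁ = .hyperbolic → kind₂ = .hyperbolic → herm (frame₁ 1) (frame₂ 0) = 1

/-- The `2n + 2` associated points of a pair of frames, in their canonical order. -/
def FramePair.points {n : ℕ} [NeZero n] (E : FramePair n) :
    Fin (n + 1) ⊕ Fin (n + 1) → ClosedHyp n :=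
  Sum.elim (assocPoint E.isFrame₁) (assocPoint E.isFrame₂)

/-- The diagonal action of `Sp(n, 1)` on tuples of points. -/
instance instActionTuple (n : ℕ) : MulAction (Sp n) (Fin (n + 1) ⊕ Fin (n + 1) → ClosedHyp n) where
  smul A p := fun i => A • p i
  one_smul p := funext fun i => one_smul (Sp n) (p i)
  mul_smul A B p := funext fun i => mul_smul A B (p i)

/-- Congruence classes of ordered `(2n + 2)`-tuples of points of the closure of hyperbolic space,
under the diagonal action of `Sp(n, 1)`. Repeated entries are kept, so that a class also
records which points of the tuple coincide. -/
abbrev Moduli (n : ℕ) : Type :=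
  MulAction.orbitRel.Quotient (Sp n) (Fin (n + 1) ⊕ Fin (n + 1) → ClosedHyp n)

/-! ### Multiplicities and canonical orbits -/

/-- `c` lists, with multiplicity and in canonical order, the representatives (of argument in
`[0, π]`) of eigenvalue classes, as in the diagonal normal forms of semisimple elements.
Hyperbolic: `c 0 = r e^{iθ}` with `r > 1`, then `c 1 = r⁻¹ e^{iθ}`, then unit complex numbers with
increasing arguments. Elliptic: unit complex numbers, first the one of the negative class, then
the other ones with increasing arguments. -/
def IsSpectrum {n : ℕ} : Kind → (Fin (n + 1) → ℂ) → Prop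
  | .hyperbolic, c => (∀ i, 0 ≤ (c i).im) ∧ 1 < ‖c 0‖ ∧ c 1 = (conj (c 0))⁻¹ ∧
      (∀ i, i ≠ 0 → i ≠ 1 → ‖c i‖ = 1) ∧
      ∀ i j, i ≠ 0 → i ≠ 1 → i ≤ j → (c i).arg ≤ (c j).arg
  | .elliptic, c => (∀ i, 0 ≤ (c i).im) ∧ (∀ i, ‖c i‖ = 1) ∧
      ∀ i j, i ≠ 0 → i ≤ j → (c i).arg ≤ (c j).arg

open Classical in
/-- The number of the eigenvalue block to which the `i`-th frame vector belongs, where the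
distinct eigenvalue classes are numbered in increasing order (by modulus, then by argument). The
function `blockLabel c` is the combinatorial form of a multiplicity `(m₁, …, m_k)`; it depends
on the sizes of the blocks and on the block of the first vector only. -/
def blockLabel {n : ℕ} (c : Fin (n + 1) → ℂ) (i : Fin (n + 1)) : ℕ :=
  ((Finset.univ.image c).filter fun μ =>
    ‖μ‖ < ‖c i‖ ∨ (‖μ‖ = ‖c i‖ ∧ μ.arg < (c i).arg)).card

/-- The functions `Fin (n + 1) → ℕ` that encode a multiplicity of the given kind. -/
def IsMultiplicity {n : ℕ} (k : Kind) (b : Fin (n + 1) → ℕ) : Prop :=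
  ∃ c : Fin (n + 1) → ℂ, IsSpectrum k c ∧ b = blockLabel c

/-- The kinds and multiplicities of a pair. -/
structure PairType (n : ℕ) where
  /-- the kind of the first element -/
  kind₁ : Kind
  /-- the multiplicity of the first element -/
  mult₁ : Fin (n + 1) → ℕ
  /-- the kind of the second element -/
  kind₂ : Kind
  /-- the multiplicity of the second element -/
  mult₂ : Fin (n + 1) → ℕ

/-- The matrix whose columns are the vectors of a frame. -/
def frameMatrix {n : ℕ} (e : Fin (n + 1) → Vec n) : Mat n := (Matrix.of e)ᵀ

/-- The matrices of the group of changes of frames that respect a multiplicity: they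
preserve the Gram matrix and are block diagonal. Up to the order of the basis this is
`ℍ* × Sp(m₁) × ⋯ × Sp(m_k)` for the hyperbolic kind, with `λ ∈ ℍ*` acting by
`(a, r) ↦ (a λ, r λ̄⁻¹)`, and `Sp(m₁ - 1, 1) × Sp(m₂) × ⋯ × Sp(m_k)` for the elliptic kind, where
`m₁` is the multiplicity of the negative class. -/
def changeOfFrame {n : ℕ} (k : Kind) (b : Fin (n + 1) → ℕ) : Set (Mat n) :=
  {M | Mᴴ * gramMatrix n k * M = gramMatrix n k ∧ ∀ i j, b i ≠ b j → M i j = 0}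

/-- `E'` is the image of `E` under the group of changes of frames for the multiplicities `b₁`, `b₂`.
If both frames are hyperbolic then the normalization of `E` and `E'` forces the two factors `ℍ*`
to act by the same `λ`. -/
def FramePair.Related {n : ℕ} (b₁ b₂ : Fin (n + 1) → ℕ) (E E' : FramePair n) : Prop :=
  E'.kind₁ = E.kind₁ ∧ E'.kind₂ = E.kind₂ ∧
  (∃ M ∈ changeOfFrame E.kind₁ b₁, frameMatrix E'.frame₁ = frameMatrix E.frame₁ * M) ∧
  (∃ M ∈ changeOfFrame E.kind₂ b₂, frameMatrix E'.frame₂ = frameMatrix E.frame₂ * M)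

/-- The congruence class of the associated points of a pair of frames, together with the kinds and
the multiplicities. -/
def FramePair.place {n : ℕ} [NeZero n] (E : FramePair n) (b₁ b₂ : Fin (n + 1) → ℕ) :
    PairType n × Moduli n :=
  (⟨E.kind₁, b₁, E.kind₂, b₂⟩, Quotient.mk'' E.points)

/-- The space `QL_n`, the disjoint union of its parts `QL_n(m₁, …, m_k; m'₁, …, m'_l)`: its points
are the orbits, under the changes of frames for the given multiplicities, of congruence classes
of associated points of pairs of frames. -/
def QL (n : ℕ) [NeZero n] : Set (Set (PairType n × Moduli n)) :=
  {O | ∃ (E : FramePair n) (b₁ b₂ : Fin (n + 1) → ℕ),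
    IsMultiplicity E.kind₁ b₁ ∧ IsMultiplicity E.kind₂ b₂ ∧
    O = {x | ∃ E' : FramePair n, E.Related b₁ b₂ E' ∧ x = E'.place b₁ b₂}}

/-- `e` is an orthonormal eigenframe of `A`, adapted to the decomposition into eigenspaces, and `c`
lists the eigenvalues of the blocks. In a hyperbolic eigenframe, `e 0` spans the attracting
and `e 1` the repelling fixed point. -/
structure IsEigenframe {n : ℕ} (k : Kind) (A : Sp n) (c : Fin (n + 1) → ℂ)
    (e : Fin (n + 1) → Vec n) : Prop where
  kind : k.Matches A
  frame : IsFrame k e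
  spectrum : IsSpectrum k c
  mem : ∀ i, e i ∈ eigenspace A (c i)

/-- `E` is an eigenframe of the pair `(A, B)`, with eigenvalues `c`, `d`. -/
def FramePair.IsEigenframeOf {n : ℕ} (E : FramePair n) (A B : Sp n) (c d : Fin (n + 1) → ℂ) :
    Prop :=
  IsEigenframe E.kind₁ A c E.frame₁ ∧ IsEigenframe E.kind₂ B d E.frame₂

/-- The canonical orbit of `(A, B)`: the congruence classes of the associated points of all
eigenframes of `(A, B)`, with the multiplicities of `A` and `B`. -/
def canonicalOrbit {n : ℕ} [NeZero n] (A B : Sp n) : Set (PairType n × Moduli n) :=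
  {x | ∃ (E : FramePair n) (c d : Fin (n + 1) → ℂ),
    E.IsEigenframeOf A B c d ∧ x = E.place (blockLabel c) (blockLabel d)}

/-! ### Eigenvalue Grassmannians -/

/-- The real subspace `W` is closed under right multiplication by `i`, that is, it is a right
complex subspace. -/
def IsComplexSubspace {n : ℕ} (W : Submodule ℝ (Vec n)) : Prop :=
  ∀ w ∈ W, op ((Complex.I : ℂ) : ℍ[ℝ]) • w ∈ W

/-- The vectors of coordinates, with respect to the frame `e`, of the elements of `S`. -/
def coords {n : ℕ} (e : Fin (n + 1) → Vec n) (S : Submodule ℝ (Vec n)) : Submodule ℝ (Vec n) where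
  carrier := {w | frameMatrix e *ᵥ w ∈ S}
  zero_mem' := by simp
  add_mem' := by
    intro x y hx hy
    simp only [Set.mem_ofPred_eq, mulVec_add] at *
    exact S.add_mem hx hy
  smul_mem' := by
    intro r x hx
    simp only [Set.mem_ofPred_eq, mulVec_smul] at *
    exact S.smul_mem r hx

/-- The eigenvalue Grassmannian of `A` for the class `[μ]`, in the coordinates given by the frame
`e`: the complex subspaces of complex dimension `m` (real dimension `2m`) of the coordinate space
`ℍ^m` of the eigenspace, where `m` is the quaternionic dimension of this eigenspace. -/
def eigenGrassmannian {n : ℕ} (A : Sp n) (e : Fin (n + 1) → Vec n) (μ : ℂ) :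
    Set (Submodule ℝ (Vec n)) :=
  {W | (∀ w ∈ W, frameMatrix e *ᵥ w ∈ eigenspace A μ) ∧ IsComplexSubspace W ∧
    Module.finrank ℝ W = 2 * Module.finrank ℍ[ℝ]ᵐᵒᵖ (eigenspace A μ)}

/-- Families of subspaces indexed by the non-real classes `[μ]`, represented by their elements of
the upper half plane. -/
abbrev GrassmannData (n : ℕ) : Type := {μ : ℂ // 0 < μ.im} → Submodule ℝ (Vec n)

/-- `γ` is the family of points that `A` determines on its eigenvalue Grassmannians, in the
coordinates given by `e`: the eigensets of the non-real classes. (For a class that is not a class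
of eigenvalues the Grassmannian is a single point, the zero space.) -/
def IsGrassmannPoint {n : ℕ} (A : Sp n) (e : Fin (n + 1) → Vec n) (γ : GrassmannData n) : Prop :=
  ∀ μ, γ μ ∈ eigenGrassmannian A e μ.1 ∧ γ μ = coords e (eigenset A μ.1)

/-- `ρ` chooses a reference pair of frames for each point of `QL_n`. -/
def IsReference {n : ℕ} [NeZero n] (ρ : Set (PairType n × Moduli n) → FramePair n) : Prop :=
  ∀ O ∈ QL n, ∃ b₁ b₂, (ρ O).place b₁ b₂ ∈ O

/-- `E` is the image of the pair of frames `R` under `C ∈ Sp(n, 1)`. -/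
def FramePair.IsTranslate {n : ℕ} (C : Sp n) (R E : FramePair n) : Prop :=
  E.kind₁ = R.kind₁ ∧ E.kind₂ = R.kind₂ ∧
  (∀ i, E.frame₁ i = C • R.frame₁ i) ∧ (∀ i, E.frame₂ i = C • R.frame₂ i)

/-- The points that `(A, B)` determines on the eigenvalue Grassmannians of `A` and `B`, where the
eigenspaces are identified with standard ones by eigenframes of `(A, B)` that are congruent to
the reference pair of frames of the canonical orbit of `(A, B)`. -/
def grassmannPoints {n : ℕ} [NeZero n] (ρ : Set (PairType n × Moduli n) → FramePair n)
    (A B : Sp n) : Set (GrassmannData n × GrassmannData n) :=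
  {γ | ∃ (E : FramePair n) (c d : Fin (n + 1) → ℂ) (C : Sp n),
    E.IsEigenframeOf A B c d ∧ FramePair.IsTranslate C (ρ (canonicalOrbit A B)) E ∧
    IsGrassmannPoint A E.frame₁ γ.1 ∧ IsGrassmannPoint B E.frame₂ γ.2}

/-- The pairs `(A, B)` and `(A', B')` are conjugate in `Sp(n, 1)`. -/
def PairConj {n : ℕ} (A B A' B' : Sp n) : Prop :=
  ∃ C : Sp n, C * A * C⁻¹ = A' ∧ C * B * C⁻¹ = B'

end QuatHyp

end

open QuatHyp

noncomputable section

namespace QuatHyp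

open Quaternion Matrix MulOpposite
open scoped LinearAlgebra.Projectivization ComplexConjugate

variable {n : ℕ}

/-! ### Quaternions and complex numbers -/

/-! A semisimple isometry `A` can be rebuilt from an eigenframe, the eigenvalue class of each frame
vector, and the eigensets `S_μ` of the non-real classes. The eigensets are needed because `A (x q) =
x μ q` when `A x = x μ`, so a vector of the eigenspace of `[μ]` does not by itself reveal its image.
Knowing `S_μ` fixes `A` on `S_μ`, hence on its quaternionic span; for real `μ` the scalar is central
and nothing more is needed (`conj_eq_of_eigenframe`).

The other invariants supply the frames and the eigenvalues. The complex representation of `A` is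
similar to `diag(c, c̄)`, so the real trace gives the multiset of classes; the multiplicity, which
also records the place of the negative class, puts them in order (`eigenvalues_eq`). The associated
points determine each frame vector up to a right scalar (`eq_smul_of_assocVec`), and eigenspaces
absorb such scalars. Hence a pair of frames whose points are congruent to those of an eigenframe is
itself carried to an eigenframe by some `C` (`exists_translate_of_place_mem`). Applied to the
reference pair this gives eigenframes `C ρ(O)`. If two pairs of isometries share the orbit `O`, with
eigenframes `C ρ(O)` and `C' ρ(O)`, then the single isometry `C' C⁻¹` matches both frames at once,
and equal Grassmannian coordinates make it conjugate both isometries.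

Existence and uniqueness of frames rest on two facts: eigenvectors that are not orthogonal have dual
classes `μ = ν̄⁻¹` (`eigenvalue_dual`), and a nonzero vector orthogonal to a negative one is
positive (`herm_self_pos_of_orthogonal`). They yield frames of genuine eigenvectors
(`exists_diagonalFrame`), uniqueness of kind and eigenvalues (`IsEigenframe.unique`), and the fact
that eigenframes differ exactly by block-diagonal changes of frame, so that the canonical orbit is
one point of `QL n` (`canonicalOrbit_eq`). The absence of common fixed points serves to make two
hyperbolic frames disjoint and normalizable. Conjugation transports every ingredient. -/

theorem exists_components (a b c d : ℝ) :
    ∃ q : ℍ[ℝ], q.re = a ∧ q.imI = b ∧ q.imJ = c ∧ q.imK = d :=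
  ⟨⟨a, b, c, d⟩, rfl, rfl, rfl, rfl⟩

/-- Every quaternion is similar to a complex number of the closed upper half plane. -/
theorem exists_similar_complex (q : ℍ[ℝ]) :
    ∃ (u : ℍ[ℝ]) (μ : ℂ), u ≠ 0 ∧ 0 ≤ μ.im ∧ q * u = u * (μ : ℍ[ℝ]) := by
  set t : ℝ := √(q.imI ^ 2 + q.imJ ^ 2 + q.imK ^ 2) with ht
  have htt : t * t = q.imI ^ 2 + q.imJ ^ 2 + q.imK ^ 2 := Real.mul_self_sqrt (by positivity)
  by_cases h : t + q.imI = 0 ∧ q.imJ = 0 ∧ q.imK = 0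
  -- Here the imaginary part of `q` is `-t i`, and conjugation by `u = j` reverses its sign.
  · obtain ⟨u, h1, h2, h3, h4⟩ := exists_components 0 0 1 0
    refine ⟨u, ⟨q.re, t⟩, ?_, Real.sqrt_nonneg _, ?_⟩
    · rintro rfl
      simp at h3
    · obtain ⟨g1, g2, g3⟩ := h
      ext <;> simp [h1, h2, h3, h4, g2, g3]
      linarith
  -- With `v` the imaginary part of `q`, this is `u = t - v i`; since `v² = -t²`, `v u = t v + t² i
  -- = u (t i)`. It vanishes exactly in the case treated above.
  · obtain ⟨u, h1, h2, h3, h4⟩ := exists_components (t + q.imI) 0 (-q.imK) q.imJ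
    refine ⟨u, ⟨q.re, t⟩, ?_, Real.sqrt_nonneg _, ?_⟩
    · rintro rfl
      refine h ⟨?_, ?_, ?_⟩
      · simpa using h1.symm
      · simpa using h4.symm
      · simpa using h3.symm
    · ext <;> simp [h1, h2, h3, h4] <;> nlinarith [htt]

/-- Similar complex numbers of the closed upper half plane are equal. -/
theorem eq_of_similar {α β : ℂ} (hα : 0 ≤ α.im) (hβ : 0 ≤ β.im) {q : ℍ[ℝ]} (hq : q ≠ 0)
    (h : (α : ℍ[ℝ]) * q = q * (β : ℍ[ℝ])) : α = β := by
  have hN : normSq q ≠ 0 := by simpa using hq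
  have h1 : normSq (α : ℍ[ℝ]) = normSq (β : ℍ[ℝ]) := by
    have := congrArg normSq h
    rw [map_mul, map_mul, mul_comm] at this
    exact mul_left_cancel₀ hN this
  have h2 : α.re = β.re := by
    have e1 := congrArg QuaternionAlgebra.re h
    have e2 := congrArg QuaternionAlgebra.imI h
    have e3 := congrArg QuaternionAlgebra.imJ h
    have e4 := congrArg QuaternionAlgebra.imK h
    simp at e1 e2 e3 e4
    rw [normSq_def'] at hN
    -- The left side is the real part of `(α q - q β) q̄`.
    have : (α.re - β.re) * (q.re ^ 2 + q.imI ^ 2 + q.imJ ^ 2 + q.imK ^ 2) = 0 := by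
      linear_combination q.re * e1 + q.imI * e2 + q.imJ * e3 + q.imK * e4
    rcases mul_eq_zero.mp this with h | h
    · linarith
    · exact absurd h hN
  have h3 : α.im = β.im := by
    simp only [normSq_def', re_coeComplex, imI_coeComplex, imJ_coeComplex, imK_coeComplex] at h1
    rw [h2] at h1
    nlinarith
  exact Complex.ext h2 h3

/-- The centralizer of a non-real complex number consists of complex numbers. -/
theorem eq_coeComplex_of_commute {μ : ℂ} (hμ : μ.im ≠ 0) {q : ℍ[ℝ]}
    (h : (μ : ℍ[ℝ]) * q = q * (μ : ℍ[ℝ])) : q = ((⟨q.re, q.imI⟩ : ℂ) : ℍ[ℝ]) := by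
  have e3 := congrArg QuaternionAlgebra.imJ h
  have e4 := congrArg QuaternionAlgebra.imK h
  simp at e3 e4
  have hJ : μ.im * q.imJ = 0 := by linarith
  have hK : μ.im * q.imK = 0 := by linarith
  ext <;> simp
  · simpa [hμ] using hJ
  · simpa [hμ] using hK

theorem coeComplex_star (μ : ℂ) : star (μ : ℍ[ℝ]) = ((conj μ : ℂ) : ℍ[ℝ]) := by
  ext <;> simp

theorem coeComplex_injective {α β : ℂ} (h : (α : ℍ[ℝ]) = (β : ℍ[ℝ])) : α = β :=
  Complex.ext (by simpa using congrArg QuaternionAlgebra.re h)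
    (by simpa using congrArg QuaternionAlgebra.imI h)

/-! ### The Hermitian form -/

/-- Displays `H` as the permutation matrix of a transposition, so that products with `H` become
reindexings. -/
theorem formMatrix_apply (i j : Fin (n + 1)) :
    formMatrix n i j = if Equiv.swap 0 (Fin.last n) i = j then 1 else 0 := by
  simp only [formMatrix, of_apply, Equiv.swap_apply_def]
  congr 1
  grind

theorem formMatrix_mulVec (z : Vec n) (i : Fin (n + 1)) :
    (formMatrix n *ᵥ z) i = z (Equiv.swap 0 (Fin.last n) i) := by
  simp [mulVec, dotProduct, formMatrix_apply]

theorem formMatrix_mul_self : formMatrix n * formMatrix n = 1 := by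
  ext1 i j
  rw [mul_apply, Finset.sum_eq_single (Equiv.swap 0 (Fin.last n) i)]
  · simp [formMatrix_apply, one_apply]
  · intro b _ hb
    simp [formMatrix_apply, hb.symm]
  · simp

theorem herm_eq_sum (z w : Vec n) :
    herm z w = ∑ i, star (w i) * z (Equiv.swap 0 (Fin.last n) i) := by
  simp [herm, dotProduct, formMatrix_mulVec]

theorem star_herm (z w : Vec n) : star (herm z w) = herm w z := by
  rw [herm_eq_sum, herm_eq_sum, star_sum]
  refine Fintype.sum_equiv (Equiv.swap 0 (Fin.last n)) _ _ fun i => ?_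
  simp

theorem herm_op_left (q : ℍ[ℝ]) (z w : Vec n) : herm (op q • z) w = herm z w * q := by
  simp [herm_eq_sum, Finset.sum_mul, mul_assoc]

theorem herm_op_right (q : ℍ[ℝ]) (z w : Vec n) : herm z (op q • w) = star q * herm z w := by
  simp [herm_eq_sum, Finset.mul_sum, mul_assoc]

theorem herm_sum_left {ι : Type*} (s : Finset ι) (f : ι → Vec n) (w : Vec n) :
    herm (∑ i ∈ s, f i) w = ∑ i ∈ s, herm (f i) w := by
  classical
  induction s using Finset.induction_on with
  | empty => simp [herm]
  | insert a s ha ih => rw [Finset.sum_insert ha, Finset.sum_insert ha, herm_add_left, ih]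

@[simp] theorem herm_zero_left (w : Vec n) : herm 0 w = 0 := by simp [herm]

@[simp] theorem herm_zero_right (w : Vec n) : herm w 0 = 0 := by simp [herm]

theorem herm_comm_zero {z w : Vec n} (h : herm z w = 0) : herm w z = 0 := by
  rw [← star_herm, h, star_zero]

theorem herm_self (v : Vec n) : herm v v = ((herm v v).re : ℍ[ℝ]) :=
  (Quaternion.star_eq_self).mp (star_herm v v)

theorem herm_self_eq_zero {v : Vec n} (h : (herm v v).re = 0) : herm v v = 0 := by
  rw [herm_self, h]; simp

theorem herm_op_self (q : ℍ[ℝ]) (v : Vec n) :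
    (herm (op q • v) (op q • v)).re = normSq q * (herm v v).re := by
  have h : star q * herm v v * q = ((normSq q * (herm v v).re : ℝ) : ℍ[ℝ]) := by
    rw [herm_self v, mul_assoc, coe_commutes, ← mul_assoc, star_mul_self]
    simp
  rw [herm_op_left, herm_op_right, h, re_coe]

theorem eq_zero_of_herm_eq_zero {v : Vec n} (h : ∀ w, herm v w = 0) : v = 0 := by
  have h1 : formMatrix n *ᵥ v = 0 := by
    funext i
    have := h (Pi.single i 1)
    simpa [herm] using this
  calc v = (formMatrix n * formMatrix n) *ᵥ v := by rw [formMatrix_mul_self, one_mulVec]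
    _ = 0 := by rw [← mulVec_mulVec, h1, mulVec_zero]

/-- A vector orthogonal to a negative vector is positive. -/
theorem herm_self_pos_of_orthogonal {x y : Vec n} (hx : (herm x x).re < 0) (hxy : herm x y = 0)
    (hy : y ≠ 0) : 0 < (herm y y).re := by
  -- On the hyperplane where the first and last coordinates agree, the form is the Euclidean one.
  have key : ∀ z : Vec n, z 0 = z (Fin.last n) → (herm z z).re = ∑ i, normSq (z i) := by
    intro z hz
    have hs : ∀ i, z (Equiv.swap 0 (Fin.last n) i) = z i := by
      intro i
      rw [Equiv.swap_apply_def]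
      split_ifs with h1 h2
      · rw [h1, hz]
      · rw [h2, hz]
      · rfl
    rw [herm_eq_sum]
    simp only [hs, star_mul_self]
    exact map_sum (QuaternionAlgebra.reₗ (-1 : ℝ) 0 (-1)) _ _
  by_contra hneg
  push Not at hneg
  have hx0 : x 0 - x (Fin.last n) ≠ 0 := by
    intro h
    have := key x (sub_eq_zero.mp h)
    have h2 : 0 ≤ ∑ i, normSq (x i) := Finset.sum_nonneg fun i _ => normSq_nonneg
    linarith
  -- `α` is chosen so that `x α + y` lies in this hyperplane. Its norm `|α|²⟨x,x⟩ + ⟨y,y⟩` is then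
  -- both nonnegative and, if `y` is not positive, nonpositive; so `α = 0` and `y = 0`.
  set α : ℍ[ℝ] := -((x 0 - x (Fin.last n))⁻¹ * (y 0 - y (Fin.last n))) with hα
  have hz := key (op α • x + y) (by
    have : (x 0 - x (Fin.last n)) * α = -(y 0 - y (Fin.last n)) := by
      rw [hα, mul_neg, mul_inv_cancel_left₀ hx0]
    simp only [Pi.add_apply, Pi.smul_apply, op_smul_eq_mul]
    rw [sub_mul] at this
    rw [← sub_eq_zero]
    rw [← sub_eq_zero] at this
    rw [← this]
    abel)
  have hyx := herm_comm_zero hxy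
  have hexp : (herm (op α • x + y) (op α • x + y)).re
      = normSq α * (herm x x).re + (herm y y).re := by
    rw [← herm_op_self, herm_add_left, herm_add_right, herm_add_right, herm_op_left α x y,
      herm_op_right α y x, hxy, hyx]
    simp
  have h2 : ∀ i, 0 ≤ normSq ((op α • x + y) i) := fun i => normSq_nonneg
  have h3 : 0 ≤ ∑ i, normSq ((op α • x + y) i) := Finset.sum_nonneg fun i _ => h2 i
  have h4 : normSq α * (herm x x).re ≤ 0 := mul_nonpos_of_nonneg_of_nonpos normSq_nonneg hx.le
  have h5 : normSq α * (herm x x).re = 0 := by linarith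
  have h6 : ∑ i, normSq ((op α • x + y) i) = 0 := by linarith
  have hα0 : α = 0 := by
    rcases mul_eq_zero.mp h5 with h | h
    · simpa using h
    · exact absurd h hx.ne
  apply hy
  funext i
  have := (Finset.sum_eq_zero_iff_of_nonneg fun i _ => h2 i).mp h6 i (Finset.mem_univ _)
  simpa [hα0] using this

theorem exists_negative (n : ℕ) [NeZero n] : ∃ x : Vec n, (herm x x).re < 0 := by
  have h0 : (0 : Fin (n + 1)) ≠ Fin.last n := by simp [Fin.ext_iff, (NeZero.ne n).symm]
  refine ⟨Pi.single 0 1 - Pi.single (Fin.last n) 1, ?_⟩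
  have e : ∀ i j : Fin (n + 1), herm (Pi.single i 1) (Pi.single j 1) = formMatrix n j i := by
    intro i j
    simp [herm]
  simp only [herm_sub_left, herm_sub_right, e, formMatrix_apply]
  simp [h0, h0.symm]

/-- A nonzero null vector is not orthogonal to a negative `x`. Hence some `b - a q` is orthogonal to
`x`; being null as well, it must vanish. Thus distinct boundary points are never orthogonal. -/
theorem exists_smul_of_null_of_orthogonal [NeZero n] {a b : Vec n} (ha : herm a a = 0)
    (hb : herm b b = 0) (ha0 : a ≠ 0) (hab : herm a b = 0) : ∃ q : ℍ[ℝ], b = op q • a := by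
  obtain ⟨x, hx⟩ := exists_negative n
  have hxa : herm a x ≠ 0 := fun h => by
    have := herm_self_pos_of_orthogonal hx (herm_comm_zero h) ha0
    simp [ha] at this
  refine ⟨(herm a x)⁻¹ * herm b x, ?_⟩
  by_contra hne
  set q := (herm a x)⁻¹ * herm b x with hq
  have h1 : herm (b - op q • a) x = 0 := by
    rw [herm_sub_left, herm_op_left, hq, mul_inv_cancel_left₀ hxa, sub_self]
  have h2 := herm_self_pos_of_orthogonal hx (herm_comm_zero h1) (sub_ne_zero.mpr hne)
  simp [herm_sub_left, herm_sub_right, herm_op_left, herm_op_right, ha, hb, hab,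
    herm_comm_zero hab] at h2

/-! ### Frames -/

theorem gramMatrix_hyperbolic_apply (i j : Fin (n + 1)) :
    gramMatrix n .hyperbolic i j = if Equiv.swap 0 1 i = j then 1 else 0 := by
  simp only [gramMatrix, of_apply, Equiv.swap_apply_def]
  congr 1
  grind

theorem gramMatrix_elliptic_apply (i j : Fin (n + 1)) :
    gramMatrix n .elliptic i j = if i = j then (if i = 0 then -1 else 1) else 0 := rfl

/-- Makes `G E* H` a left inverse of a frame matrix `E`, because `E* H E = G`. -/
theorem gramMatrix_mul_self (k : Kind) : gramMatrix n k * gramMatrix n k = 1 := by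
  ext1 i j
  cases k
  · rw [mul_apply, Finset.sum_eq_single (Equiv.swap 0 1 i)]
    · simp [gramMatrix_hyperbolic_apply, one_apply]
    · intro b _ hb
      simp [gramMatrix_hyperbolic_apply, hb.symm]
    · simp
  · rw [mul_apply, Finset.sum_eq_single i]
    · by_cases h : i = 0
      · subst h
        by_cases hj : j = 0
        · subst hj
          simp [gramMatrix_elliptic_apply]
        · simp [gramMatrix_elliptic_apply, one_apply, Ne.symm hj]
      · simp [gramMatrix_elliptic_apply, one_apply, h]
    · intro b _ hb
      simp [gramMatrix_elliptic_apply, hb.symm]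
    · simp

theorem gramMatrix_symm (k : Kind) (i j : Fin (n + 1)) :
    gramMatrix n k i j = gramMatrix n k j i := by
  cases k
  · simp only [gramMatrix, of_apply]
    congr 1
    grind
  · simp only [gramMatrix, of_apply]
    grind

theorem frameMatrix_apply (e : Fin (n + 1) → Vec n) (i j : Fin (n + 1)) :
    frameMatrix e i j = e j i := rfl

theorem frameMatrix_mulVec (e : Fin (n + 1) → Vec n) (q : Vec n) :
    frameMatrix e *ᵥ q = ∑ i, op (q i) • e i := by
  funext j
  simp [mulVec, dotProduct, frameMatrix_apply]

theorem frameMatrix_mulVec_single (e : Fin (n + 1) → Vec n) (i : Fin (n + 1)) :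
    frameMatrix e *ᵥ Pi.single i 1 = e i := by
  rw [mulVec_single_one]; rfl

theorem mul_frameMatrix (A : Mat n) (e : Fin (n + 1) → Vec n) :
    A * frameMatrix e = frameMatrix fun i => A *ᵥ e i := by
  ext1 i j
  simp [mul_apply, frameMatrix_apply, mulVec, dotProduct]

theorem gram_apply (e e' : Fin (n + 1) → Vec n) (i j : Fin (n + 1)) :
    ((frameMatrix e)ᴴ * formMatrix n * frameMatrix e') i j = herm (e' j) (e i) := by
  rw [mul_assoc, mul_frameMatrix, mul_apply]
  rfl

theorem isFrame_iff {k : Kind} {e : Fin (n + 1) → Vec n} :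
    IsFrame k e ↔ (frameMatrix e)ᴴ * formMatrix n * frameMatrix e = gramMatrix n k := by
  constructor
  · intro h
    ext1 i j
    rw [gram_apply, h, gramMatrix_symm]
  · intro h i j
    rw [← gram_apply, h, gramMatrix_symm]

/-- The inverse of the matrix of a frame. -/
def frameInv (k : Kind) (e : Fin (n + 1) → Vec n) : Mat n :=
  gramMatrix n k * (frameMatrix e)ᴴ * formMatrix n

theorem frameInv_mul {k : Kind} {e : Fin (n + 1) → Vec n} (h : IsFrame k e) :
    frameInv k e * frameMatrix e = 1 := by
  rw [frameInv, mul_assoc, mul_assoc, ← mul_assoc _ (formMatrix n), isFrame_iff.mp h,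
    gramMatrix_mul_self]

theorem mul_frameInv {k : Kind} {e : Fin (n + 1) → Vec n} (h : IsFrame k e) :
    frameMatrix e * frameInv k e = 1 :=
  -- Over a division ring a left inverse of a square matrix is also a right inverse.
  (mul_eq_one_comm_of_card_eq (Fin (n + 1)) (Fin (n + 1)) ℍ rfl).mp (frameInv_mul h)

theorem frameMatrix_mulVec_inj {k : Kind} {e : Fin (n + 1) → Vec n} (h : IsFrame k e)
    {p q : Vec n} (hpq : frameMatrix e *ᵥ p = frameMatrix e *ᵥ q) : p = q := by
  have := congrArg (fun z => frameInv k e *ᵥ z) hpq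
  simpa [mulVec_mulVec, frameInv_mul h] using this

theorem exists_coords {k : Kind} {e : Fin (n + 1) → Vec n} (h : IsFrame k e) (v : Vec n) :
    ∃ q : Vec n, v = frameMatrix e *ᵥ q :=
  ⟨frameInv k e *ᵥ v, by rw [mulVec_mulVec, mul_frameInv h, one_mulVec]⟩

theorem linearIndependent_frame {k : Kind} {e : Fin (n + 1) → Vec n} (h : IsFrame k e) :
    LinearIndependent ℍ[ℝ]ᵐᵒᵖ e := by
  rw [Fintype.linearIndependent_iff]
  intro g hg i
  have h1 : frameMatrix e *ᵥ (fun i => unop (g i)) = frameMatrix e *ᵥ 0 := by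
    rw [frameMatrix_mulVec]
    simpa using hg
  have := congrFun (frameMatrix_mulVec_inj h h1) i
  simpa using this

theorem frame_ne_zero {k : Kind} {e : Fin (n + 1) → Vec n} (h : IsFrame k e) (i : Fin (n + 1)) :
    e i ≠ 0 := (linearIndependent_frame h).ne_zero i

/-! ### Eigenvectors -/

theorem mem_eigenset {A : Sp n} {μ : ℂ} {v : Vec n} :
    v ∈ eigenset A μ ↔ A • v = op (μ : ℍ[ℝ]) • v := Iff.rfl

theorem eigenset_herm {A : Sp n} {μ ν : ℂ} {v w : Vec n} (hv : v ∈ eigenset A μ)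
    (hw : w ∈ eigenset A ν) : ((conj ν : ℂ) : ℍ[ℝ]) * herm v w * (μ : ℍ[ℝ]) = herm v w := by
  conv_rhs => rw [← herm_smul_smul A, mem_eigenset.mp hv, mem_eigenset.mp hw, herm_op_right,
    herm_op_left, coeComplex_star, ← mul_assoc]

theorem eigenvalue_ne_zero {A : Sp n} {μ : ℂ} {v : Vec n} (hv : v ∈ eigenset A μ) (h0 : v ≠ 0) :
    μ ≠ 0 := by
  rintro rfl
  rw [mem_eigenset] at hv
  simp only [coeComplex_zero, op_zero, zero_smul] at hv
  exact h0 ((smul_eq_zero_iff_eq A).mp hv)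

theorem smul_mem_eigenset {A : Sp n} {μ : ℂ} {v : Vec n} (hv : v ∈ eigenset A μ) {q : ℍ[ℝ]}
    (hq : (μ : ℍ[ℝ]) * q = q * (μ : ℍ[ℝ])) : op q • v ∈ eigenset A μ := by
  rw [mem_eigenset] at *
  rw [smul_comm, hv, smul_smul, smul_smul, ← op_mul, ← op_mul, hq]

/-- Two eigenvectors that are not orthogonal have dual eigenvalues. -/
theorem eigenvalue_dual {A : Sp n} {μ ν : ℂ} {v w : Vec n} (hv : v ∈ eigenset A μ)
    (hw : w ∈ eigenset A ν) (hμ : 0 ≤ μ.im) (hν : 0 ≤ ν.im) (h : herm v w ≠ 0) :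
    μ = (conj ν)⁻¹ ∧ (μ : ℍ[ℝ]) * herm v w = herm v w * (μ : ℍ[ℝ]) := by
  have hw0 : w ≠ 0 := by rintro rfl; simp at h
  have hν0 : conj ν ≠ 0 := by simpa using eigenvalue_ne_zero hw hw0
  have h1 : (((conj ν)⁻¹ : ℂ) : ℍ[ℝ]) * herm v w = herm v w * (μ : ℍ[ℝ]) := by
    conv_lhs => rw [← eigenset_herm hv hw]
    rw [← mul_assoc, ← mul_assoc, ← coeComplex_mul, inv_mul_cancel₀ hν0]
    simp
  have h2 : (conj ν)⁻¹ = μ := by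
    refine eq_of_similar ?_ hμ h h1
    rw [Complex.inv_im]
    simp only [Complex.conj_im, neg_neg]
    exact div_nonneg hν (Complex.normSq_nonneg _)
  exact ⟨h2.symm, by rw [← h1, h2]⟩

theorem norm_eq_one_of_eq_inv_conj {μ : ℂ} (h : μ = (conj μ)⁻¹) (h0 : μ ≠ 0) : ‖μ‖ = 1 := by
  have h1 := congrArg norm h
  rw [norm_inv, RCLike.norm_conj] at h1
  have h2 : ‖μ‖ ≠ 0 := by simpa using h0
  have h3 : ‖μ‖ * ‖μ‖ = 1 := by
    nth_rewrite 1 [h1]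
    exact inv_mul_cancel₀ h2
  nlinarith [norm_nonneg μ]

theorem inv_conj_eq_self {μ : ℂ} (h : ‖μ‖ = 1) : (conj μ)⁻¹ = μ := by
  rw [← Complex.inv_eq_conj h, inv_inv]

/-- A vector that is not null pairs nontrivially with itself, so its class is its own dual. -/
theorem norm_eq_one_of_anisotropic {A : Sp n} {μ : ℂ} {v : Vec n} (hv : v ∈ eigenset A μ)
    (hμ : 0 ≤ μ.im) (h : (herm v v).re ≠ 0) : ‖μ‖ = 1 := by
  have h0 : herm v v ≠ 0 := fun h0 => h (by simp [h0])
  have hv0 : v ≠ 0 := by rintro rfl; simp at h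
  exact norm_eq_one_of_eq_inv_conj (eigenvalue_dual hv hv hμ hμ h0).1 (eigenvalue_ne_zero hv hv0)

/-- The eigenvectors whose eigenvalue lies in the closed upper half plane. -/
def eigenvectors (A : Sp n) : Set (Vec n) := {v | ∃ μ : ℂ, 0 ≤ μ.im ∧ v ∈ eigenset A μ}

/-- Rescaling an eigenvector by `u` replaces its eigenvalue `q` by `u⁻¹ q u`, which can be made
complex. -/
theorem exists_smul_mem_eigenvectors {A : Sp n} {v : Vec n} {q : ℍ[ℝ]} (h : A • v = op q • v) :
    ∃ u : ℍ[ℝ], u ≠ 0 ∧ op u • v ∈ eigenvectors A := by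
  obtain ⟨u, μ, hu, hμ, hq⟩ := exists_similar_complex q
  refine ⟨u, hu, μ, hμ, ?_⟩
  rw [mem_eigenset, smul_comm, h, smul_smul, smul_smul, ← op_mul, ← op_mul, hq]

theorem span_eigenvectors {A : Sp n} (hA : IsSemisimple A) :
    Submodule.span ℍ[ℝ]ᵐᵒᵖ (eigenvectors A) = ⊤ := by
  obtain ⟨v, hv⟩ := hA
  rw [eq_top_iff, ← v.span_eq, Submodule.span_le]
  rintro _ ⟨i, rfl⟩
  obtain ⟨q, hq⟩ := hv i
  obtain ⟨u, hu, h⟩ := exists_smul_mem_eigenvectors (A := A) hq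
  have := Submodule.smul_mem _ (op u⁻¹) (Submodule.subset_span (R := ℍ[ℝ]ᵐᵒᵖ) h)
  rwa [smul_smul, ← op_mul, mul_inv_cancel₀ hu, op_one, one_smul] at this

instance : Module.Finite ℍ[ℝ]ᵐᵒᵖ ℍ[ℝ] :=
  ⟨⟨{1}, by
    rw [Finset.coe_singleton, eq_top_iff]
    intro q _
    simpa using Submodule.smul_mem _ (op q) (Submodule.mem_span_singleton_self (1 : ℍ[ℝ]))⟩⟩

theorem finrank_vec {A : Sp n} (hA : IsSemisimple A) :
    Module.finrank ℍ[ℝ]ᵐᵒᵖ (Vec n) = n + 1 := by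
  obtain ⟨v, -⟩ := hA
  simpa using Module.finrank_eq_card_basis v

/-! ### Orthogonal bases of eigenvectors -/

theorem herm_eq_zero_of_mem_span {S : Set (Vec n)} {w : Vec n} (h : ∀ u ∈ S, herm u w = 0)
    {v : Vec n} (hv : v ∈ Submodule.span ℍ[ℝ]ᵐᵒᵖ S) : herm v w = 0 := by
  induction hv using Submodule.span_induction with
  | mem x hx => exact h x hx
  | zero => simp
  | add x y _ _ hx hy => rw [herm_add_left, hx, hy, add_zero]
  | smul a x _ hx => rw [← op_unop a, herm_op_left, hx, zero_mul]

/-- A nondegenerate subspace that is spanned by eigenvectors. -/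
structure IsAdapted (A : Sp n) (W : Submodule ℍ[ℝ]ᵐᵒᵖ (Vec n)) : Prop where
  le_span : W ≤ Submodule.span ℍ[ℝ]ᵐᵒᵖ (W ∩ eigenvectors A)
  nondegenerate : ∀ w ∈ W, (∀ w' ∈ W, herm w w' = 0) → w = 0

theorem IsAdapted.top {A : Sp n} (hA : IsSemisimple A) : IsAdapted A ⊤ where
  le_span := by simp [span_eigenvectors hA]
  nondegenerate w _ h := eq_zero_of_herm_eq_zero fun w' => h w' trivial

/-- The induction tool for splitting off eigenvectors. An orthogonal projection that respects
eigenvectors carries a spanning set of `W` to one of `W'`; a vector of `W'` orthogonal to `W'` is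
also orthogonal to the kernel part `w - f w`, hence to `W`. -/
theorem IsAdapted.of_projection {A : Sp n} {W W' : Submodule ℍ[ℝ]ᵐᵒᵖ (Vec n)} (hW : IsAdapted A W)
    (hle : W' ≤ W) (f : Vec n →ₗ[ℍ[ℝ]ᵐᵒᵖ] Vec n) (hf : ∀ w ∈ W, f w ∈ W') (hid : ∀ w ∈ W', f w = w)
    (heig : ∀ w ∈ W, w ∈ eigenvectors A → f w ∈ eigenvectors A)
    (horth : ∀ w ∈ W, ∀ w' ∈ W', herm w' (w - f w) = 0) : IsAdapted A W' where
  le_span w hw := by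
    have h1 := Submodule.mem_map_of_mem (f := f) (hW.le_span (hle hw))
    rw [hid w hw, Submodule.map_span] at h1
    refine Submodule.span_mono ?_ h1
    rintro _ ⟨v, ⟨hv, hv'⟩, rfl⟩
    exact ⟨hf v hv, heig v hv hv'⟩
  nondegenerate w hw h := by
    refine hW.nondegenerate w (hle hw) fun w' hw' => ?_
    have h1 := horth w' hw' w hw
    rw [herm_sub_right, h _ (hf w' hw'), sub_zero] at h1
    exact h1

theorem IsAdapted.exists_nonorthogonal {A : Sp n} {W : Submodule ℍ[ℝ]ᵐᵒᵖ (Vec n)}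
    (hW : IsAdapted A W) {w : Vec n} (hw : w ∈ W) (h0 : w ≠ 0) :
    ∃ u ∈ W, u ∈ eigenvectors A ∧ herm w u ≠ 0 := by
  by_contra hcon
  push Not at hcon
  refine h0 (hW.nondegenerate w hw fun w' hw' => herm_comm_zero ?_)
  exact herm_eq_zero_of_mem_span (fun u hu => herm_comm_zero (hcon u hu.1 hu.2)) (hW.le_span hw')

/-- The real number `1` or `-1`. -/
def IsSign (ε : ℝ) : Prop := ε = 1 ∨ ε = -1

theorem exists_normalized {v : Vec n}
    (h : (herm v v).re ≠ 0) : ∃ (s : ℝ) (ε : ℝ), IsSign ε ∧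
      herm (s • v) (s • v) = (ε : ℍ[ℝ]) := by
  set x := (herm v v).re
  have hx : 0 < |x| := abs_pos.mpr h
  have hs : (√|x|)⁻¹ * (√|x|)⁻¹ = |x|⁻¹ := by
    rw [← mul_inv, Real.mul_self_sqrt hx.le]
  refine ⟨(√|x|)⁻¹, |x|⁻¹ * x, ?_, ?_⟩
  · rcases lt_or_gt_of_ne h with h | h
    · right
      rw [abs_of_neg h]
      field_simp
    · left
      rw [abs_of_pos h, inv_mul_cancel₀ h.ne']
  · rw [herm_smul_left, herm_smul_right, herm_self v, smul_smul, hs]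
    rw [coe_mul, coe_mul_eq_smul]

/-- Polarization: two null eigenvectors that are not orthogonal have the same class, since dual unit
classes coincide, and a suitable sum of them is an eigenvector that is not null. -/
theorem IsAdapted.exists_anisotropic {A : Sp n} {W : Submodule ℍ[ℝ]ᵐᵒᵖ (Vec n)}
    (hW : IsAdapted A W) (hne : W ≠ ⊥)
    (hunit : ∀ w ∈ W, ∀ μ : ℂ, 0 ≤ μ.im → w ∈ eigenset A μ → w ≠ 0 → ‖μ‖ = 1) :
    ∃ w ∈ W, ∃ (μ : ℂ) (ε : ℝ), 0 ≤ μ.im ∧ w ∈ eigenset A μ ∧ IsSign ε ∧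
      herm w w = (ε : ℍ[ℝ]) := by
  have key : ∃ w ∈ W, ∃ μ : ℂ, 0 ≤ μ.im ∧ w ∈ eigenset A μ ∧ (herm w w).re ≠ 0 := by
    obtain ⟨w, hw, hw0⟩ := Submodule.exists_mem_ne_zero_of_ne_bot hne
    obtain ⟨u, huW, ⟨μ, hμ, hu⟩, huw⟩ := hW.exists_nonorthogonal hw hw0
    have hu0 : u ≠ 0 := by rintro rfl; simp at huw
    obtain ⟨v, hvW, ⟨ν, hν, hv⟩, huv⟩ := hW.exists_nonorthogonal huW hu0
    have hv0 : v ≠ 0 := by rintro rfl; simp at huv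
    by_cases h1 : (herm u u).re = 0
    swap
    · exact ⟨u, huW, μ, hμ, hu, h1⟩
    by_cases h2 : (herm v v).re = 0
    swap
    · exact ⟨v, hvW, ν, hν, hv, h2⟩
    obtain ⟨hd, hc⟩ := eigenvalue_dual hu hv hμ hν huv
    rw [inv_conj_eq_self (hunit v hvW ν hν hv hv0)] at hd
    subst hd
    -- The norm of `u + v⟨u,v⟩` is `2|⟨u,v⟩|²`, and the coefficient commutes with `μ`, so the sum
    -- stays in the eigenset.
    refine ⟨u + op (herm u v) • v, W.add_mem huW (W.smul_mem _ hvW), μ, hμ,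
      Submodule.add_mem _ hu (smul_mem_eigenset hv hc), ?_⟩
    have h3 : (herm (op (herm u v) • v) (op (herm u v) • v)).re = 0 := by
      rw [herm_op_self, h2, mul_zero]
    rw [herm_add_left, herm_add_right, herm_add_right, herm_self_eq_zero h1, herm_self_eq_zero h3,
      herm_op_left, herm_op_right, star_herm, ← star_herm u v, star_mul_self]
    simpa using huv
  obtain ⟨w, hw, μ, hμ, hwμ, hre⟩ := key
  obtain ⟨s, ε, hε, hs⟩ := exists_normalized hre
  refine ⟨s • w, ?_, μ, ε, hμ, Submodule.smul_mem _ _ hwμ, hε, hs⟩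
  have : s • w = op (s : ℍ[ℝ]) • w := by
    funext i
    ext <;> simp [mul_comm]
  rw [this]
  exact W.smul_mem _ hw

/-- The map `v ↦ u ⟨v, w⟩`. -/
def rankOne (w u : Vec n) : Vec n →ₗ[ℍ[ℝ]ᵐᵒᵖ] Vec n where
  toFun v := op (herm v w) • u
  map_add' x y := by rw [herm_add_left, op_add, add_smul]
  map_smul' a x := by
    rw [← op_unop a, herm_op_left, op_mul, mul_smul]
    rfl

theorem rankOne_apply (w u v : Vec n) : rankOne w u v = op (herm v w) • u := rfl

/-- The orthogonal complement of a vector. -/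
def perp (w : Vec n) : Submodule ℍ[ℝ]ᵐᵒᵖ (Vec n) where
  carrier := {v | herm v w = 0}
  zero_mem' := by simp
  add_mem' := by
    intro x y hx hy
    simp only [Set.mem_ofPred_eq] at *
    rw [herm_add_left, hx, hy, add_zero]
  smul_mem' := by
    intro a x hx
    simp only [Set.mem_ofPred_eq] at *
    rw [← op_unop a, herm_op_left, hx, zero_mul]

theorem mem_perp {v w : Vec n} : v ∈ perp w ↔ herm v w = 0 := Iff.rfl

/-- The projection of an eigenvector to an eigenvector with a dual eigenvalue. -/
theorem rankOne_mem_eigenset {A : Sp n} {μ ν ν' : ℂ} {v w u : Vec n} (hv : v ∈ eigenset A μ)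
    (hw : w ∈ eigenset A ν) (hu : u ∈ eigenset A ν') (hμ : 0 ≤ μ.im) (hν : 0 ≤ ν.im)
    (hd : ν' = (conj ν)⁻¹) : rankOne w u v ∈ eigenset A μ := by
  rw [rankOne_apply]
  by_cases h : herm v w = 0
  · simp [h]
  · obtain ⟨h1, h2⟩ := eigenvalue_dual hv hw hμ hν h
    have : μ = ν' := by rw [h1, hd]
    subst this
    exact smul_mem_eigenset hu h2

theorem finrank_le_of_le_sup {W W' : Submodule ℍ[ℝ]ᵐᵒᵖ (Vec n)} {w : Vec n}
    (h : W ≤ W' ⊔ Submodule.span ℍ[ℝ]ᵐᵒᵖ {w}) :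
    Module.finrank ℍ[ℝ]ᵐᵒᵖ W ≤ Module.finrank ℍ[ℝ]ᵐᵒᵖ W' + 1 := by
  refine (Submodule.finrank_mono h).trans ((Submodule.finrank_add_le_finrank_add_finrank _ _).trans ?_)
  have := finrank_span_le_card (R := ℍ[ℝ]ᵐᵒᵖ) ({w} : Set (Vec n))
  simp at this
  omega

theorem le_sup_span {W W' : Submodule ℍ[ℝ]ᵐᵒᵖ (Vec n)} {w : Vec n}
    (h : ∀ v ∈ W, ∃ q : ℍ[ℝ], v - op q • w ∈ W') : W ≤ W' ⊔ Submodule.span ℍ[ℝ]ᵐᵒᵖ {w} := by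
  intro v hv
  obtain ⟨q, hq⟩ := h v hv
  rw [← sub_add_cancel v (op q • w)]
  exact Submodule.add_mem_sup hq (Submodule.smul_mem _ _ (Submodule.mem_span_singleton_self w))

/-- Gram–Schmidt inside the eigenvectors: split off a normalized one and pass to its orthogonal
complement in `W`, which remains adapted. Unit eigenvalues are required because otherwise
eigenvectors may all be null. -/
theorem IsAdapted.exists_orthonormal {A : Sp n} (d : ℕ) :
    ∀ {W : Submodule ℍ[ℝ]ᵐᵒᵖ (Vec n)} (_ : IsAdapted A W) (_ : d ≤ Module.finrank ℍ[ℝ]ᵐᵒᵖ W)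
    (_ : ∀ w ∈ W, ∀ μ : ℂ, 0 ≤ μ.im → w ∈ eigenset A μ → w ≠ 0 → ‖μ‖ = 1),
    ∃ (e : Fin d → Vec n) (c : Fin d → ℂ) (ε : Fin d → ℝ), (∀ i, e i ∈ W) ∧ (∀ i, 0 ≤ (c i).im) ∧
      (∀ i, e i ∈ eigenset A (c i)) ∧ (∀ i, IsSign (ε i)) ∧
      ∀ i j, herm (e i) (e j) = if i = j then (ε i : ℍ[ℝ]) else 0 := by
  induction d with
  | zero =>
    intros
    exact ⟨Fin.elim0, Fin.elim0, Fin.elim0, fun i => i.elim0, fun i => i.elim0, fun i => i.elim0,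
      fun i => i.elim0, fun i => i.elim0⟩
  | succ d ih =>
    intro W hW hd hunit
    have hne : W ≠ ⊥ := by
      rintro rfl
      simp at hd
    obtain ⟨w, hw, μ, ε, hμ, hwμ, hε, hww⟩ := hW.exists_anisotropic hne hunit
    have hεε : ε * ε = 1 := by rcases hε with rfl | rfl <;> norm_num
    have hre : (herm w w).re ≠ 0 := by
      rw [hww]
      rcases hε with rfl | rfl <;> simp
    have hnorm := norm_eq_one_of_anisotropic hwμ hμ hre
    -- The orthogonal projection along `w`; the factor `ε = ε⁻¹` corrects for `⟨w,w⟩ = ε`.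
    set f : Vec n →ₗ[ℍ[ℝ]ᵐᵒᵖ] Vec n := LinearMap.id - rankOne w (ε • w) with hf
    have hfa : ∀ v, f v = v - op (herm v w) • ε • w := fun v => rfl
    have hfW : ∀ v ∈ W, f v ∈ W ⊓ perp w := by
      intro v hv
      have hreal : op (herm v w) • ε • w = op ((ε : ℍ[ℝ]) * herm v w) • w := by
        rw [op_mul, mul_smul]
        congr 1
        funext i
        ext <;> simp [mul_comm]
      refine ⟨?_, ?_⟩
      · rw [hfa, hreal]
        exact W.sub_mem hv (W.smul_mem _ hw)
      · rw [SetLike.mem_coe, mem_perp, hfa, herm_sub_left, hreal, herm_op_left, hww, ← mul_assoc,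
          ← coe_mul, hεε]
        simp
    have hW' : IsAdapted A (W ⊓ perp w) := by
      refine hW.of_projection inf_le_left f hfW ?_ ?_ ?_
      · rintro v ⟨-, hv⟩
        rw [hfa, mem_perp.mp hv]
        simp
      · rintro v hv ⟨ν, hν, hvν⟩
        refine ⟨ν, hν, Submodule.sub_mem _ hvν ?_⟩
        exact rankOne_mem_eigenset hvν hwμ (Submodule.smul_mem _ ε hwμ) hν hμ
          (inv_conj_eq_self hnorm).symm
      · rintro v hv v' ⟨-, hv'⟩
        rw [hfa, sub_sub_cancel, herm_op_right, herm_smul_right, mem_perp.mp hv']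
        simp
    have hrank : d ≤ Module.finrank ℍ[ℝ]ᵐᵒᵖ ↥(W ⊓ perp w) := by
      have : Module.finrank ℍ[ℝ]ᵐᵒᵖ W ≤ Module.finrank ℍ[ℝ]ᵐᵒᵖ ↥(W ⊓ perp w) + 1 := by
        refine finrank_le_of_le_sup (w := w) (le_sup_span fun v hv => ⟨(ε : ℍ[ℝ]) * herm v w, ?_⟩)
        have := hfW v hv
        rw [hfa] at this
        convert this using 2
        rw [op_mul, mul_smul]
        congr 1
        funext i
        ext <;> simp [mul_comm]
      omega
    obtain ⟨e, c, ε', h1, h2, h3, h4, h5⟩ := ih hW' hrank fun v hv => hunit v hv.1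
    refine ⟨Fin.cons w e, Fin.cons μ c, Fin.cons ε ε', ?_, ?_, ?_, ?_, ?_⟩
    · exact Fin.cases hw fun i => (h1 i).1
    · exact Fin.cases hμ h2
    · exact Fin.cases hwμ h3
    · exact Fin.cases hε h4
    · refine Fin.cases (Fin.cases ?_ fun j => ?_) fun i => Fin.cases ?_ fun j => ?_
      · simpa using hww
      · simpa [(Fin.succ_ne_zero j).symm] using herm_comm_zero (mem_perp.mp (h1 j).2)
      · simpa using mem_perp.mp (h1 i).2
      · simpa using h5 i j

/-! ### Existence of frames of eigenvectors -/

/-- A frame that consists of eigenvectors. -/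
structure IsDiagonalFrame (k : Kind) (A : Sp n) (c : Fin (n + 1) → ℂ) (e : Fin (n + 1) → Vec n) :
    Prop where
  frame : IsFrame k e
  spectrum : IsSpectrum k c
  mem : ∀ i, e i ∈ eigenset A (c i)

theorem IsSpectrum.im_nonneg {k : Kind} {c : Fin (n + 1) → ℂ} (h : IsSpectrum k c) (i : Fin (n + 1)) :
    0 ≤ (c i).im := by
  cases k <;> exact h.1 i

/-- If all signs were positive, the form would be a sum of squared norms of coordinates, against
`exists_negative`. -/
theorem exists_negative_of_orthonormal [NeZero n] {e : Fin (n + 1) → Vec n} {ε : Fin (n + 1) → ℝ}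
    (hε : ∀ i, IsSign (ε i)) (he : ∀ i j, herm (e i) (e j) = if i = j then (ε i : ℍ[ℝ]) else 0) :
    ∃ i, ε i = -1 := by
  by_contra hcon
  push Not at hcon
  have hone : ∀ i, ε i = 1 := fun i => (hε i).resolve_right (hcon i)
  have hgram : (frameMatrix e)ᴴ * formMatrix n * frameMatrix e = 1 := by
    ext1 i j
    rw [gram_apply, he, hone, one_apply]
    simp [eq_comm]
  have hinv : frameMatrix e * ((frameMatrix e)ᴴ * formMatrix n) = 1 :=
    (mul_eq_one_comm_of_card_eq (Fin (n + 1)) (Fin (n + 1)) ℍ rfl).mp hgram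
  obtain ⟨x, hx⟩ := exists_negative n
  set q := ((frameMatrix e)ᴴ * formMatrix n) *ᵥ x
  have hxq : x = ∑ i, op (q i) • e i := by
    rw [← frameMatrix_mulVec, mulVec_mulVec, hinv, one_mulVec]
  have hei : ∀ i, herm (e i) x = star (q i) := by
    intro i
    rw [← star_herm, hxq, herm_sum_left]
    simp [herm_op_left, he, hone]
  have hpos : (herm x x).re = ∑ i, normSq (q i) := by
    nth_rewrite 1 [hxq]
    rw [herm_sum_left]
    simp only [herm_op_left, hei, star_mul_self]
    exact map_sum (QuaternionAlgebra.reₗ (-1 : ℝ) 0 (-1)) _ _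
  have : 0 ≤ ∑ i, normSq (q i) := Finset.sum_nonneg fun i _ => normSq_nonneg
  linarith

/-- Gram–Schmidt applies to the whole space. The signature allows exactly one negative vector: any
vector orthogonal to it is positive. -/
theorem exists_diagonalFrame_elliptic [NeZero n] {A : Sp n} (hA : IsSemisimple A)
    (hunit : ∀ w : Vec n, ∀ μ : ℂ, 0 ≤ μ.im → w ∈ eigenset A μ → w ≠ 0 → ‖μ‖ = 1) :
    ∃ c e, IsDiagonalFrame .elliptic A c e := by
  obtain ⟨e, c, ε, -, h2, h3, h4, h5⟩ := (IsAdapted.top hA).exists_orthonormal (n + 1)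
    (by rw [finrank_top, finrank_vec hA]) fun w _ => hunit w
  have h0 : ∀ i, e i ≠ 0 := by
    intro i hi
    have := h5 i i
    rw [hi] at this
    rcases h4 i with h | h <;> simp [h] at this
  obtain ⟨a, ha⟩ := exists_negative_of_orthonormal h4 h5
  have huniq : ∀ i, i ≠ a → ε i = 1 := by
    intro i hi
    refine (h4 i).resolve_right fun h => ?_
    have := herm_self_pos_of_orthogonal (x := e a) (y := e i) (by simp [h5, ha])
      (by simp [h5, hi.symm]) (h0 i)
    simp [h5, h] at this
    linarith
  -- The sorting key is the argument, except for the negative vector: arguments here are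
  -- nonnegative, so `-1` puts that vector first.
  set t : Fin (n + 1) → ℝ := fun i => if i = a then -1 else (c i).arg with ht
  set σ := Tuple.sort t
  have hσ : Monotone (t ∘ σ) := Tuple.monotone_sort t
  have hσ0 : σ 0 = a := by
    have h := hσ (Fin.zero_le (σ.symm a))
    simp only [Function.comp, Equiv.apply_symm_apply] at h
    by_contra hne
    have : 0 ≤ (c (σ 0)).arg := Complex.arg_nonneg_iff.mpr (h2 _)
    simp only [ht, if_true, hne, if_false] at h
    linarith
  have hσn : ∀ i, i ≠ 0 → σ i ≠ a := fun i hi h => hi (σ.injective (h.trans hσ0.symm))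
  refine ⟨c ∘ σ, e ∘ σ, ?_, ⟨fun i => h2 _, fun i => hunit _ _ (h2 _) (h3 _) (h0 _), ?_⟩,
    fun i => h3 _⟩
  · intro i j
    rw [gramMatrix_elliptic_apply, Function.comp, Function.comp, h5]
    by_cases hij : i = j
    · subst hij
      by_cases hi : i = 0
      · subst hi
        simp [hσ0, ha]
      · simp [hi, huniq _ (hσn i hi)]
    · simp [hij]
  · intro i j hi hij
    have h := hσ hij
    have hj : j ≠ 0 := by
      rintro rfl
      exact hi (Fin.le_zero_iff.mp hij)
    simpa [ht, hσn i hi, hσn j hj] using h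

/-- An eigenvector with a non-unit class is null, and nondegeneracy pairs it with an eigenvector of
the dual class. The orthogonal complement of this hyperbolic plane is positive, so its classes are
unit and Gram–Schmidt applies there. -/
theorem exists_diagonalFrame_hyperbolic [NeZero n] {A : Sp n} (hA : IsSemisimple A)
    {μ : ℂ} {a : Vec n} (hμ : 0 ≤ μ.im) (ha : a ∈ eigenset A μ) (ha0 : a ≠ 0) (hn : 1 < ‖μ‖) :
    ∃ c e, IsDiagonalFrame .hyperbolic A c e := by
  have hμ0 : μ ≠ 0 := by
    rintro rfl
    simp at hn
    linarith
  have hnull : ∀ {ν : ℂ} {v : Vec n}, v ∈ eigenset A ν → 0 ≤ ν.im → ‖ν‖ ≠ 1 → herm v v = 0 :=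
    fun hv hν h1 => herm_self_eq_zero (by
      by_contra h
      exact h1 (norm_eq_one_of_anisotropic hv hν h))
  have haa := hnull ha hμ hn.ne'
  obtain ⟨r, hr, hrμ, har⟩ : ∃ r : Vec n, r ∈ eigenset A (conj μ)⁻¹ ∧ 0 ≤ ((conj μ)⁻¹).im ∧
      herm a r = 1 := by
    obtain ⟨r, -, ⟨ν, hν, hr⟩, h⟩ := (IsAdapted.top hA).exists_nonorthogonal trivial ha0
    have h' : herm r a ≠ 0 := fun h0 => h (herm_comm_zero h0)
    obtain ⟨hd, hc⟩ := eigenvalue_dual hr ha hν hμ h'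
    rw [hd] at hr hc hν
    -- This factor achieves `⟨a,r⟩ = 1` and preserves the eigenset because `⟨r,a⟩` commutes with the
    -- eigenvalue.
    refine ⟨op (herm r a)⁻¹ • r, smul_mem_eigenset hr ?_, hν, ?_⟩
    · exact (Commute.inv_right₀ (a := (((conj μ)⁻¹ : ℂ) : ℍ[ℝ])) (b := herm r a) hc).eq
    · rw [herm_op_right, star_inv₀, star_herm, inv_mul_cancel₀ h]
  have hra : herm r a = 1 := by rw [← star_herm, har, star_one]
  have hrn : ‖(conj μ)⁻¹‖ < 1 := by
    rw [norm_inv, RCLike.norm_conj]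
    exact inv_lt_one_of_one_lt₀ hn
  have hrr := hnull hr hrμ hrn.ne
  set W := perp a ⊓ perp r with hW
  have hpos : ∀ w ∈ W, w ≠ 0 → 0 < (herm w w).re := by
    rintro w ⟨h1, h2⟩ h0
    -- The vector `a - r` has norm `-2`.
    refine herm_self_pos_of_orthogonal (x := a - r) ?_ ?_ h0
    · simp [herm_sub_left, herm_sub_right, haa, hrr, har, hra]
    · rw [herm_sub_left, herm_comm_zero h1, herm_comm_zero h2, sub_zero]
  have hunit : ∀ w ∈ W, ∀ ν : ℂ, 0 ≤ ν.im → w ∈ eigenset A ν → w ≠ 0 → ‖ν‖ = 1 :=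
    fun w hw ν hν hwν h0 => norm_eq_one_of_anisotropic hwν hν (hpos w hw h0).ne'
  -- Since `a` and `r` are null with `⟨a,r⟩ = 1`, the coefficient of `a` is read off by pairing with
  -- `r`, and conversely.
  set f : Vec n →ₗ[ℍ[ℝ]ᵐᵒᵖ] Vec n := LinearMap.id - rankOne r a - rankOne a r with hf
  have hfa : ∀ v, f v = v - op (herm v r) • a - op (herm v a) • r := fun v => rfl
  have hfW : ∀ v, f v ∈ W := by
    intro v
    constructor
    · simp [mem_perp, hfa, herm_sub_left, herm_op_left, haa, hra]
    · simp [mem_perp, hfa, herm_sub_left, herm_op_left, hrr, har]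
  have hadapted : IsAdapted A W := by
    refine (IsAdapted.top hA).of_projection le_top f (fun v _ => hfW v) ?_ ?_ ?_
    · rintro v ⟨h1, h2⟩
      rw [hfa, mem_perp.mp h1, mem_perp.mp h2]
      simp
    · rintro v - ⟨ν, hν, hvν⟩
      refine ⟨ν, hν, Submodule.sub_mem _ (Submodule.sub_mem _ hvν ?_) ?_⟩
      · exact rankOne_mem_eigenset hvν hr ha hν hrμ (by simp)
      · exact rankOne_mem_eigenset hvν ha hr hν hμ rfl
    · rintro v - v' ⟨h1, h2⟩
      rw [hfa, sub_sub, sub_sub_cancel, herm_add_right, herm_op_right, herm_op_right,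
        mem_perp.mp h1, mem_perp.mp h2]
      simp
  obtain ⟨m, rfl⟩ := Nat.exists_eq_succ_of_ne_zero (NeZero.ne n)
  have hrank : m ≤ Module.finrank ℍ[ℝ]ᵐᵒᵖ W := by
    have h1 : Module.finrank ℍ[ℝ]ᵐᵒᵖ (⊤ : Submodule ℍ[ℝ]ᵐᵒᵖ (Vec (m + 1))) ≤
        Module.finrank ℍ[ℝ]ᵐᵒᵖ (perp a) + 1 := by
      refine finrank_le_of_le_sup (w := r) (le_sup_span fun v _ => ⟨herm v a, ?_⟩)
      simp [mem_perp, herm_sub_left, herm_op_left, hra]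
    have h2 : Module.finrank ℍ[ℝ]ᵐᵒᵖ (perp a) ≤ Module.finrank ℍ[ℝ]ᵐᵒᵖ W + 1 := by
      refine finrank_le_of_le_sup (w := a) (le_sup_span fun v hv => ⟨herm v r, ?_, ?_⟩)
      · rw [SetLike.mem_coe, mem_perp, herm_sub_left, mem_perp.mp hv, herm_op_left, haa]
        simp
      · simp [mem_perp, herm_sub_left, herm_op_left, har]
    rw [finrank_top, finrank_vec hA] at h1
    omega
  obtain ⟨x, c, ε, h1, h2, h3, h4, h5⟩ := hadapted.exists_orthonormal m hrank hunit
  have hε : ∀ i, ε i = 1 := by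
    intro i
    have hx0 : x i ≠ 0 := by
      intro hi
      have := h5 i i
      rw [hi] at this
      rcases h4 i with h | h <;> simp [h] at this
    refine (h4 i).resolve_right fun h => ?_
    have := hpos _ (h1 i) hx0
    simp [h5, h] at this
    linarith
  set σ := Tuple.sort (fun i => (c i).arg)
  have hσ : Monotone ((fun i => (c i).arg) ∘ σ) := Tuple.monotone_sort _
  refine ⟨Fin.cons μ (Fin.cons (conj μ)⁻¹ (c ∘ σ)), Fin.cons a (Fin.cons r (x ∘ σ)), ?_,
    ⟨?_, ?_, ?_, ?_, ?_⟩, ?_⟩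
  · have hx : ∀ i, herm (x (σ i)) a = 0 ∧ herm (x (σ i)) r = 0 := fun i => h1 (σ i)
    have hx' : ∀ i, herm a (x (σ i)) = 0 ∧ herm r (x (σ i)) = 0 :=
      fun i => ⟨herm_comm_zero (hx i).1, herm_comm_zero (hx i).2⟩
    have hs0 : ∀ j : Fin m, (j.succ.succ : Fin (m + 2)) ≠ 0 := fun j => Fin.succ_ne_zero _
    have hs1 : ∀ j : Fin m, (j.succ.succ : Fin (m + 2)) ≠ 1 := fun j h =>
      Fin.succ_ne_zero j (Fin.succ_injective _ h)
    have hs0' := fun j => (hs0 j).symm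
    have hs1' := fun j => (hs1 j).symm
    refine Fin.cases (Fin.cases ?_ (Fin.cases ?_ fun j => ?_))
      (Fin.cases (Fin.cases ?_ (Fin.cases ?_ fun j => ?_))
        fun i => Fin.cases ?_ (Fin.cases ?_ fun j => ?_))
    · simp [gramMatrix, haa]
    · simp [gramMatrix, har]
    · simp [gramMatrix, hx', hs0', hs0, hs1]
    · simp [gramMatrix, hra]
    · simp [gramMatrix, hx, hs0, hs1]
    · simp [gramMatrix, hrr]
    · simp [gramMatrix, hx', hs1', hs0, hs1]
    · simp [gramMatrix, hx, hs0, hs1]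
    · simp [gramMatrix, h5, hε, hs0, hs1]
  · exact Fin.cases hμ (Fin.cases hrμ fun i => h2 _)
  · exact hn
  · rfl
  · refine Fin.cases (fun h => absurd rfl h) (Fin.cases (fun _ h => absurd rfl h) fun i _ _ => ?_)
    have h0 : x (σ i) ≠ 0 := by
      intro hi
      have := h5 (σ i) (σ i)
      rw [hi] at this
      simp [hε] at this
    exact hunit _ (h1 _) _ (h2 _) (h3 _) h0
  · refine Fin.cases (fun _ h => absurd rfl h) (Fin.cases (fun _ _ h => absurd rfl h) fun i => ?_)
    refine Fin.cases (fun _ _ h => ?_) (Fin.cases (fun _ _ h => ?_) fun j _ _ h => ?_)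
    · simp at h
    · simp [Fin.le_def] at h
    · exact hσ (Fin.succ_le_succ_iff.mp (Fin.succ_le_succ_iff.mp h))
  · exact Fin.cases ha (Fin.cases hr fun i => h3 _)

/-- Either all classes are unit, or there is one of modulus greater than `1`: a class of modulus
less than `1` has a dual of modulus greater than `1`. -/
theorem exists_diagonalFrame [NeZero n] {A : Sp n} (hA : IsSemisimple A) :
    ∃ k c e, IsDiagonalFrame k A c e := by
  by_cases hunit : ∀ w : Vec n, ∀ μ : ℂ, 0 ≤ μ.im → w ∈ eigenset A μ → w ≠ 0 → ‖μ‖ = 1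
  · exact ⟨_, exists_diagonalFrame_elliptic hA hunit⟩
  push Not at hunit
  obtain ⟨w, μ, hμ, hw, h0, h1⟩ := hunit
  have hμ0 := eigenvalue_ne_zero hw h0
  rcases lt_or_gt_of_ne h1 with h1 | h1
  · obtain ⟨r, -, ⟨ν, hν, hr⟩, h⟩ := (IsAdapted.top hA).exists_nonorthogonal trivial h0
    have hr0 : r ≠ 0 := by rintro rfl; simp at h
    have h' : herm r w ≠ 0 := fun h0 => h (herm_comm_zero h0)
    have hd := (eigenvalue_dual hr hw hν hμ h').1
    refine ⟨_, exists_diagonalFrame_hyperbolic hA hν hr hr0 ?_⟩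
    rw [hd, norm_inv, RCLike.norm_conj]
    exact (one_lt_inv₀ (norm_pos_iff.mpr hμ0)).mpr h1
  · exact ⟨_, exists_diagonalFrame_hyperbolic hA hμ hw h0 h1⟩

/-! ### The kind of an isometry with a frame of eigenvectors -/

theorem smul_mk_eq_iff {A : Sp n} {v : Vec n} (hv : v ≠ 0) :
    A • Projectivization.mk ℍ[ℝ]ᵐᵒᵖ v hv = Projectivization.mk ℍ[ℝ]ᵐᵒᵖ v hv ↔
      ∃ q : ℍ[ℝ], A • v = op q • v := by
  change Projectivization.mk ℍ[ℝ]ᵐᵒᵖ (A • v) ((smul_ne_zero_iff_ne A).mpr hv) = _ ↔ _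
  rw [Projectivization.mk_eq_mk_iff]
  constructor
  · rintro ⟨a, ha⟩
    exact ⟨unop (a : ℍ[ℝ]ᵐᵒᵖ), ha.symm⟩
  · rintro ⟨q, hq⟩
    have hq0 : op q ≠ 0 := by
      intro h
      rw [h, zero_smul] at hq
      exact hv ((smul_eq_zero_iff_eq A).mp hq)
    exact ⟨Units.mk0 _ hq0, hq.symm⟩

theorem mk_eq_mk_iff_op {v w : Vec n} (hv : v ≠ 0) (hw : w ≠ 0) :
    Projectivization.mk ℍ[ℝ]ᵐᵒᵖ v hv = Projectivization.mk ℍ[ℝ]ᵐᵒᵖ w hw ↔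
      ∃ q : ℍ[ℝ], v = op q • w := by
  rw [Projectivization.mk_eq_mk_iff]
  constructor
  · rintro ⟨a, ha⟩
    exact ⟨unop (a : ℍ[ℝ]ᵐᵒᵖ), ha.symm⟩
  · rintro ⟨q, hq⟩
    have hq0 : op q ≠ 0 := by
      intro h
      rw [h, zero_smul] at hq
      exact hv hq
    exact ⟨Units.mk0 _ hq0, hq.symm⟩

/-- In the hyperbolic case, a fixed null line is spanned by an eigenvector `w`. It must be
orthogonal to `e 0` or `e 1`, and orthogonal null vectors are proportional, so there are only two
such lines. -/
theorem IsDiagonalFrame.kind_matches [NeZero n] {k : Kind} {A : Sp n} {c : Fin (n + 1) → ℂ}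
    {e : Fin (n + 1) → Vec n} (h : IsDiagonalFrame k A c e) : k.Matches A := by
  have h0 := frame_ne_zero h.frame
  have hfix : ∀ i, A • Projectivization.mk ℍ[ℝ]ᵐᵒᵖ (e i) (h0 i) =
      Projectivization.mk ℍ[ℝ]ᵐᵒᵖ (e i) (h0 i) :=
    fun i => (smul_mk_eq_iff (h0 i)).mpr ⟨_, mem_eigenset.mp (h.mem i)⟩
  cases k with
  | elliptic =>
    exact ⟨_, ⟨e 0, h0 0, rfl, by simp [h.frame 0 0, gramMatrix]⟩, hfix 0⟩
  | hyperbolic =>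
    have h01 := zero_ne_one_fin n
    obtain ⟨-, hn, hc1, -, -⟩ := h.spectrum
    have e00 : herm (e 0) (e 0) = 0 := by simp [h.frame 0 0, gramMatrix, h01]
    have e11 : herm (e 1) (e 1) = 0 := by simp [h.frame 1 1, gramMatrix, h01.symm]
    have e01 : herm (e 0) (e 1) = 1 := by simp [h.frame 0 1, gramMatrix]
    have e10 : herm (e 1) (e 0) = 1 := by simp [h.frame 1 0, gramMatrix]
    have hne : Projectivization.mk ℍ[ℝ]ᵐᵒᵖ (e 0) (h0 0) ≠
        Projectivization.mk ℍ[ℝ]ᵐᵒᵖ (e 1) (h0 1) := by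
      rw [Ne, mk_eq_mk_iff_op]
      rintro ⟨q, hq⟩
      rw [hq, herm_op_left, e11, zero_mul] at e01
      exact zero_ne_one e01
    have hset : {p : HP n | p ∈ boundary n ∧ A • p = p} =
        {Projectivization.mk ℍ[ℝ]ᵐᵒᵖ (e 0) (h0 0), Projectivization.mk ℍ[ℝ]ᵐᵒᵖ (e 1) (h0 1)} := by
      ext p
      constructor
      · rintro ⟨⟨v, hv, rfl, hvv⟩, hp⟩
        obtain ⟨q, hq⟩ := (smul_mk_eq_iff hv).mp hp
        obtain ⟨u, hu, μ, hμ, hw⟩ := exists_smul_mem_eigenvectors hq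
        set w := op u • v with hwdef
        have hvw : v = op u⁻¹ • w := by
          rw [hwdef, smul_smul, ← op_mul, mul_inv_cancel₀ hu, op_one, one_smul]
        have hw0 : w ≠ 0 := by
          intro h
          rw [h, smul_zero] at hvw
          exact hv hvw
        have hww : herm w w = 0 := herm_self_eq_zero (by rw [hwdef, herm_op_self, hvv, mul_zero])
        have fin : ∀ i, herm (e i) (e i) = 0 → herm (e i) w = 0 →
            Projectivization.mk ℍ[ℝ]ᵐᵒᵖ v hv = Projectivization.mk ℍ[ℝ]ᵐᵒᵖ (e i) (h0 i) := by
          intro i hi hiw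
          obtain ⟨x, hx⟩ := exists_smul_of_null_of_orthogonal hi hww (h0 i) hiw
          rw [mk_eq_mk_iff_op]
          exact ⟨_, by rw [hvw, hx, smul_smul, ← op_mul]⟩
        by_cases hw0' : herm (e 0) w = 0
        · exact Or.inl (fin 0 e00 hw0')
        by_cases hw1 : herm (e 1) w = 0
        · exact Or.inr (fin 1 e11 hw1)
        exfalso
        -- Otherwise both `c 0` and `c 1` would be dual to the class of `w`, although their moduli
        -- differ.
        have d0 := (eigenvalue_dual (h.mem 0) hw (h.spectrum.im_nonneg 0) hμ hw0').1
        have d1 := (eigenvalue_dual (h.mem 1) hw (h.spectrum.im_nonneg 1) hμ hw1).1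
        rw [← d0] at d1
        have := congrArg norm (d1.symm.trans hc1)
        rw [norm_inv, RCLike.norm_conj] at this
        have h2 : ‖c 0‖⁻¹ < 1 := inv_lt_one_of_one_lt₀ hn
        linarith
      · rintro (rfl | rfl)
        · exact ⟨⟨e 0, h0 0, rfl, by simp [e00]⟩, hfix 0⟩
        · exact ⟨⟨e 1, h0 1, rfl, by simp [e11]⟩, hfix 1⟩
    change Set.ncard _ = 2
    rw [hset, Set.ncard_pair hne]

/-! ### Eigenspaces in terms of frames -/

theorem smul_frameMatrix_mulVec {k : Kind} {A : Sp n} {c : Fin (n + 1) → ℂ}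
    {e : Fin (n + 1) → Vec n} (h : IsDiagonalFrame k A c e) (q : Vec n) :
    A • (frameMatrix e *ᵥ q) = frameMatrix e *ᵥ fun i => (c i : ℍ[ℝ]) * q i := by
  rw [frameMatrix_mulVec, frameMatrix_mulVec, Finset.smul_sum]
  refine Finset.sum_congr rfl fun i _ => ?_
  rw [smul_comm, mem_eigenset.mp (h.mem i), smul_smul, ← op_mul]

theorem mem_eigenset_iff_coords {k : Kind} {A : Sp n} {c : Fin (n + 1) → ℂ}
    {e : Fin (n + 1) → Vec n} (h : IsDiagonalFrame k A c e) {μ : ℂ} {q : Vec n} :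
    frameMatrix e *ᵥ q ∈ eigenset A μ ↔ ∀ i, (c i : ℍ[ℝ]) * q i = q i * (μ : ℍ[ℝ]) := by
  rw [mem_eigenset, smul_frameMatrix_mulVec h, ← mulVec_smul]
  constructor
  · intro h1 i
    exact congrFun (frameMatrix_mulVec_inj h.frame h1) i
  · intro h1
    congr 1
    funext i
    exact h1 i

/-- In diagonal coordinates the eigenvalue equation reads `c i * q i = q i * μ`; distinct
representatives in the closed upper half plane are not similar, so coordinates outside the block
vanish. -/
theorem eigenspace_eq_span_of_diagonal {k : Kind} {A : Sp n} {c : Fin (n + 1) → ℂ}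
    {e : Fin (n + 1) → Vec n} (h : IsDiagonalFrame k A c e) {μ : ℂ} (hμ : 0 ≤ μ.im) :
    eigenspace A μ = Submodule.span ℍ[ℝ]ᵐᵒᵖ (Set.range fun i : {i // c i = μ} => e i) := by
  apply le_antisymm
  · refine Submodule.span_le.mpr fun x hx => ?_
    obtain ⟨q, rfl⟩ := exists_coords h.frame x
    have hq := (mem_eigenset_iff_coords h).mp hx
    rw [frameMatrix_mulVec]
    refine Submodule.sum_mem _ fun i _ => ?_
    by_cases h0 : q i = 0
    · simp [h0]
    · have hi := eq_of_similar (h.spectrum.im_nonneg i) hμ h0 (hq i)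
      exact Submodule.smul_mem _ _ (Submodule.subset_span ⟨⟨i, hi⟩, rfl⟩)
  · refine Submodule.span_le.mpr ?_
    rintro _ ⟨⟨i, rfl⟩, rfl⟩
    exact Submodule.subset_span (h.mem i)

theorem finrank_span_block {k : Kind} {e : Fin (n + 1) → Vec n} (h : IsFrame k e)
    (c : Fin (n + 1) → ℂ) (μ : ℂ) :
    Module.finrank ℍ[ℝ]ᵐᵒᵖ (Submodule.span ℍ[ℝ]ᵐᵒᵖ (Set.range fun i : {i // c i = μ} => e i)) =
      Fintype.card {i // c i = μ} :=
  finrank_span_eq_card ((linearIndependent_frame h).comp _ Subtype.val_injective)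

theorem span_block_le {k : Kind} {A : Sp n} {c : Fin (n + 1) → ℂ}
    {e : Fin (n + 1) → Vec n} (h : IsEigenframe k A c e) (μ : ℂ) :
    Submodule.span ℍ[ℝ]ᵐᵒᵖ (Set.range fun i : {i // c i = μ} => e i) ≤ eigenspace A μ := by
  refine Submodule.span_le.mpr ?_
  rintro _ ⟨⟨i, rfl⟩, rfl⟩
  exact h.mem i

theorem IsDiagonalFrame.isEigenframe [NeZero n] {k : Kind} {A : Sp n} {c : Fin (n + 1) → ℂ}
    {e : Fin (n + 1) → Vec n} (h : IsDiagonalFrame k A c e) : IsEigenframe k A c e :=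
  ⟨h.kind_matches, h.frame, h.spectrum, fun i => Submodule.subset_span (h.mem i)⟩

/-- Each block of an eigenframe is independent inside its eigenspace, so it is no larger than the
corresponding block of the diagonal frame. Both families of block sizes add up to `n + 1`, which
forces equality. -/
theorem card_eigenvalue_eq {k k' : Kind} {A : Sp n} {c c' : Fin (n + 1) → ℂ}
    {e e' : Fin (n + 1) → Vec n} (h : IsDiagonalFrame k A c e) (h' : IsEigenframe k' A c' e')
    (μ : ℂ) : Fintype.card {i // c' i = μ} = Fintype.card {i // c i = μ} := by
  have hle : ∀ ν : ℂ, 0 ≤ ν.im →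
      Fintype.card {i // c' i = ν} ≤ Fintype.card {i // c i = ν} := by
    intro ν hν
    rw [← finrank_span_block h'.frame, ← finrank_span_block h.frame,
      ← eigenspace_eq_span_of_diagonal h hν]
    exact Submodule.finrank_mono (span_block_le h' ν)
  classical
  set s := Finset.univ.image c ∪ Finset.univ.image c' with hs
  have hcard : ∀ f : Fin (n + 1) → ℂ, Finset.univ.image f ⊆ s →
      ∑ ν ∈ s, Fintype.card {i // f i = ν} = n + 1 := by
    intro f hf
    have := Finset.card_eq_sum_card_fiberwise (s := Finset.univ) (f := f) (t := s)
      fun i _ => hf (Finset.mem_image_of_mem f (Finset.mem_univ i))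
    rw [Finset.card_univ, Fintype.card_fin] at this
    exact (Finset.sum_congr rfl fun ν _ => Fintype.card_subtype _).trans this.symm
  have him : ∀ ν ∈ s, 0 ≤ ν.im := by
    intro ν hν
    rcases Finset.mem_union.mp hν with h1 | h1 <;> obtain ⟨i, -, rfl⟩ := Finset.mem_image.mp h1
    · exact h.spectrum.im_nonneg i
    · exact h'.spectrum.im_nonneg i
  by_cases hμ : μ ∈ s
  · refine (Finset.sum_eq_sum_iff_of_le fun ν hν => hle ν (him ν hν)).mp ?_ μ hμ
    rw [hcard c' Finset.subset_union_right, hcard c Finset.subset_union_left]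
  · have hzero : ∀ f : Fin (n + 1) → ℂ, Finset.univ.image f ⊆ s →
        Fintype.card {i // f i = μ} = 0 := by
      intro f hf
      rw [Fintype.card_eq_zero_iff]
      exact ⟨fun ⟨i, hi⟩ => hμ (hf (Finset.mem_image.mpr ⟨i, Finset.mem_univ i, hi⟩))⟩
    rw [hzero c' Finset.subset_union_right, hzero c Finset.subset_union_left]

theorem perm_ofFn_of_card_eq {c c' : Fin (n + 1) → ℂ}
    (h : ∀ μ : ℂ, Fintype.card {i // c' i = μ} = Fintype.card {i // c i = μ}) :
    (List.ofFn c).Perm (List.ofFn c') := by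
  rw [← Multiset.coe_eq_coe, ← Fin.univ_val_map, ← Fin.univ_val_map]
  classical
  ext μ
  have key : ∀ f : Fin (n + 1) → ℂ, Multiset.count μ (Multiset.map f Finset.univ.val) =
      Fintype.card {i // f i = μ} := by
    intro f
    rw [Multiset.count_map, Fintype.card_subtype]
    simp only [eq_comm]
    rfl
  rw [key, key, h]

theorem eigenspace_eq_span [NeZero n] {k : Kind} {A : Sp n} (hA : IsSemisimple A)
    {c : Fin (n + 1) → ℂ} {e : Fin (n + 1) → Vec n} (h : IsEigenframe k A c e) {μ : ℂ}
    (hμ : 0 ≤ μ.im) :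
    eigenspace A μ = Submodule.span ℍ[ℝ]ᵐᵒᵖ (Set.range fun i : {i // c i = μ} => e i) := by
  obtain ⟨k', c', e', h'⟩ := exists_diagonalFrame hA
  refine (Submodule.eq_of_le_of_finrank_eq (span_block_le h μ) ?_).symm
  rw [finrank_span_block h.frame, eigenspace_eq_span_of_diagonal h' hμ,
    finrank_span_block h'.frame, card_eigenvalue_eq h' h]

/-! ### Uniqueness of the eigenvalues -/

/-- Two sorted rearrangements of one list agree. The key `φ` need not be injective, so only its
values are compared. -/
theorem comp_eq_of_perm {c c' : Fin n → ℂ} (h : (List.ofFn c).Perm (List.ofFn c')) (φ : ℂ → ℝ)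
    (hc : Monotone (φ ∘ c)) (hc' : Monotone (φ ∘ c')) : φ ∘ c = φ ∘ c' := by
  have h1 : (List.ofFn (φ ∘ c)).Perm (List.ofFn (φ ∘ c')) := by
    rw [← List.map_ofFn, ← List.map_ofFn]
    exact h.map φ
  apply List.ofFn_injective
  exact h1.eq_of_pairwise (fun a b _ _ h1 h2 => le_antisymm h1 h2)
    (List.pairwise_ofFn.mpr fun i j hij => hc hij.le)
    (List.pairwise_ofFn.mpr fun i j hij => hc' hij.le)

theorem IsSpectrum.eq_zero_of_one_lt {c : Fin (n + 1) → ℂ} (h : IsSpectrum .hyperbolic c)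
    {i : Fin (n + 1)} (hi : 1 < ‖c i‖) : i = 0 := by
  obtain ⟨-, h0, h1, h2, -⟩ := h
  by_contra hi0
  by_cases hi1 : i = 1
  · rw [hi1, h1, norm_inv, RCLike.norm_conj] at hi
    exact absurd (inv_lt_one_of_one_lt₀ h0) (not_lt.mpr hi.le)
  · rw [h2 i hi0 hi1] at hi
    exact lt_irrefl _ hi

/-- The normal form is a sorted list. In the elliptic case the negative class is exempt from the
order and is not visible in the multiset, so it has to be prescribed. -/
theorem IsSpectrum.eq_of_perm [NeZero n] {k : Kind} {c c' : Fin (n + 1) → ℂ} (h : IsSpectrum k c)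
    (h' : IsSpectrum k c') (hp : (List.ofFn c).Perm (List.ofFn c'))
    (h0 : k = .elliptic → c 0 = c' 0) : c = c' := by
  cases k with
  | elliptic =>
    have h00 := h0 rfl
    obtain ⟨-, hn, hs⟩ := h
    obtain ⟨-, hn', hs'⟩ := h'
    rw [List.ofFn_succ, List.ofFn_succ, h00] at hp
    have := comp_eq_of_perm hp.cons_inv Complex.arg
      (fun i j hij => hs _ _ (Fin.succ_ne_zero i) (Fin.succ_le_succ_iff.mpr hij))
      (fun i j hij => hs' _ _ (Fin.succ_ne_zero i) (Fin.succ_le_succ_iff.mpr hij))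
    funext i
    refine Fin.cases h00 (fun j => ?_) i
    exact Complex.ext_norm_arg ((hn _).trans (hn' _).symm) (congrFun this j)
  | hyperbolic =>
    have h00 : c 0 = c' 0 := by
      have hmem : c 0 ∈ List.ofFn c' := hp.subset (List.mem_ofFn.mpr ⟨0, rfl⟩)
      obtain ⟨i, hi⟩ := List.mem_ofFn.mp hmem
      have : i = 0 := h'.eq_zero_of_one_lt (by rw [hi]; exact h.2.1)
      rw [← hi, this]
    -- A key that sorts the whole hyperbolic list: the values `-2` and `-1` put the expanding and
    -- the contracting class before the nonnegative arguments of the unit classes.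
    set φ : ℂ → ℝ := fun z => if 1 < ‖z‖ then -2 else if ‖z‖ < 1 then -1 else z.arg with hφ
    have hmono : ∀ f : Fin (n + 1) → ℂ, IsSpectrum .hyperbolic f → Monotone (φ ∘ f) := by
      rintro f ⟨g1, g2, g3, g4, g5⟩
      have hf1 : ‖f 1‖ < 1 := by
        rw [g3, norm_inv, RCLike.norm_conj]
        exact inv_lt_one_of_one_lt₀ g2
      have v0 : φ (f 0) = -2 := by simp [hφ, g2]
      have v1 : φ (f 1) = -1 := by simp [hφ, hf1, hf1.le]
      have v2 : ∀ i, i ≠ 0 → i ≠ 1 → φ (f i) = (f i).arg := by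
        intro i hi0 hi1
        simp [hφ, g4 i hi0 hi1]
      have va : ∀ i, 0 ≤ (f i).arg := fun i => Complex.arg_nonneg_iff.mpr (g1 i)
      intro i j hij
      simp only [Function.comp]
      by_cases hi0 : i = 0
      · subst hi0
        rw [v0]
        by_cases hj0 : j = 0
        · rw [hj0, v0]
        by_cases hj1 : j = 1
        · rw [hj1, v1]; norm_num
        rw [v2 j hj0 hj1]
        linarith [va j]
      have hj0 : j ≠ 0 := by
        rintro rfl
        exact hi0 (Fin.le_zero_iff.mp hij)
      by_cases hi1 : i = 1
      · subst hi1
        rw [v1]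
        by_cases hj1 : j = 1
        · rw [hj1, v1]
        rw [v2 j hj0 hj1]
        linarith [va j]
      have hj1 : j ≠ 1 := by
        rintro rfl
        obtain ⟨m, rfl⟩ := Nat.exists_eq_succ_of_ne_zero (NeZero.ne n)
        have : i.val ≤ 1 := hij
        have h2 : i.val ≠ 0 := fun h => hi0 (Fin.ext h)
        exact hi1 (Fin.ext (by simp; omega))
      rw [v2 i hi0 hi1, v2 j hj0 hj1]
      exact g5 i j hi0 hi1 hij
    have key := comp_eq_of_perm hp φ (hmono c h) (hmono c' h')
    funext i
    by_cases hi0 : i = 0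
    · rw [hi0, h00]
    by_cases hi1 : i = 1
    · rw [hi1, h.2.2.1, h'.2.2.1, h00]
    have n1 := h.2.2.2.1 i hi0 hi1
    have n2 := h'.2.2.2.1 i hi0 hi1
    have := congrFun key i
    simp [hφ, n1, n2] at this
    exact Complex.ext_norm_arg (n1.trans n2.symm) this

theorem herm_eq_zero_of_mem_eigenspaces {A : Sp n} {μ ν : ℂ} (hμ : 0 ≤ μ.im) (hν : 0 ≤ ν.im)
    (hd : μ ≠ (conj ν)⁻¹) {x y : Vec n} (hx : x ∈ eigenspace A μ) (hy : y ∈ eigenspace A ν) :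
    herm x y = 0 := by
  refine herm_eq_zero_of_mem_span (fun u hu => herm_comm_zero ?_) hx
  refine herm_eq_zero_of_mem_span (fun v hv => herm_comm_zero ?_) hy
  by_contra h
  exact hd (eigenvalue_dual hu hv hμ hν h).1

/-- The kind and the eigenvalues of an eigenframe are determined by the isometry. -/
theorem IsEigenframe.unique [NeZero n] {A : Sp n} (hA : IsSemisimple A) {k k' : Kind}
    {c c' : Fin (n + 1) → ℂ} {e e' : Fin (n + 1) → Vec n} (h : IsEigenframe k A c e)
    (h' : IsEigenframe k' A c' e') : k = k' ∧ c = c' := by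
  obtain ⟨k'', c'', e'', h''⟩ := exists_diagonalFrame hA
  have hp : (List.ofFn c).Perm (List.ofFn c') :=
    perm_ofFn_of_card_eq fun μ => (card_eigenvalue_eq h'' h' μ).trans (card_eigenvalue_eq h'' h μ).symm
  have hkind : ∀ {f f' : Fin (n + 1) → ℂ}, (List.ofFn f).Perm (List.ofFn f') →
      IsSpectrum .hyperbolic f → ¬ IsSpectrum .elliptic f' := by
    intro f f' hff h1 h2
    obtain ⟨i, hi⟩ := List.mem_ofFn.mp (hff.subset (List.mem_ofFn.mpr ⟨0, rfl⟩))
    have := h2.2.1 i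
    rw [hi] at this
    exact h1.2.1.ne' this
  have hk : k = k' := by
    cases k <;> cases k'
    · rfl
    · exact (hkind hp h.spectrum h'.spectrum).elim
    · exact (hkind hp.symm h'.spectrum h.spectrum).elim
    · rfl
  subst hk
  refine ⟨rfl, h.spectrum.eq_of_perm h'.spectrum hp ?_⟩
  rintro rfl
  by_contra hne
  -- If the negative vectors belonged to different unit classes they would be orthogonal, which the
  -- signature excludes.
  have horth : herm (e 0) (e' 0) = 0 :=
    herm_eq_zero_of_mem_eigenspaces (h.spectrum.im_nonneg 0) (h'.spectrum.im_nonneg 0)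
      (by rwa [inv_conj_eq_self (h'.spectrum.2.1 0)]) (h.mem 0) (h'.mem 0)
  have := herm_self_pos_of_orthogonal (by simp [h.frame 0 0, gramMatrix]) horth
    (frame_ne_zero h'.frame 0)
  simp [h'.frame 0 0, gramMatrix] at this
  linarith

/-! ### Points of the eigenvalue Grassmannians -/

/-- In diagonal coordinates the eigenset consists of the vectors supported on the block of `μ` with
complex entries, because the centralizer of a non-real `μ` is `ℂ`. This gives two real dimensions
per frame vector. -/
theorem finrank_coords_eigenset [NeZero n] {A : Sp n} (hA : IsSemisimple A) {k : Kind}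
    {e : Fin (n + 1) → Vec n} (he : IsFrame k e) {μ : ℂ} (hμ : 0 < μ.im) :
    Module.finrank ℝ (coords e (eigenset A μ)) =
      2 * Module.finrank ℍ[ℝ]ᵐᵒᵖ (eigenspace A μ) := by
  obtain ⟨k', c, e', h⟩ := exists_diagonalFrame hA
  let extend : ({i // c i = μ} → ℂ) → Vec n := fun z i =>
    if hi : c i = μ then (z ⟨i, hi⟩ : ℍ[ℝ]) else 0
  let g : ({i // c i = μ} → ℂ) →ₗ[ℝ] Vec n :=
    { toFun := fun z => frameInv k e *ᵥ (frameMatrix e' *ᵥ extend z)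
      map_add' := by
        intro x y
        rw [← mulVec_add, ← mulVec_add]
        congr 2
        funext i
        by_cases hi : c i = μ <;> simp [extend, hi]
      map_smul' := by
        intro r x
        rw [RingHom.id_apply, ← mulVec_smul, ← mulVec_smul]
        congr 2
        funext i
        by_cases hi : c i = μ
        · simp only [extend, hi, Pi.smul_apply]
          ext <;> simp
        · simp [extend, hi] }
  have hg : ∀ z, frameMatrix e *ᵥ g z = frameMatrix e' *ᵥ extend z := by
    intro z
    change frameMatrix e *ᵥ (frameInv k e *ᵥ (frameMatrix e' *ᵥ extend z)) = _
    rw [mulVec_mulVec, mul_frameInv he, one_mulVec]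
  have hinj : Function.Injective g := by
    intro x y hxy
    have h1 : frameMatrix e' *ᵥ extend x = frameMatrix e' *ᵥ extend y := by
      rw [← hg, ← hg, hxy]
    have h2 := frameMatrix_mulVec_inj h.frame h1
    funext ⟨i, hi⟩
    have := congrFun h2 i
    simp only [extend, hi] at this
    exact coeComplex_injective this
  have hrange : LinearMap.range g = coords e (eigenset A μ) := by
    ext w
    constructor
    · rintro ⟨z, rfl⟩
      change frameMatrix e *ᵥ g z ∈ eigenset A μ
      rw [hg, mem_eigenset_iff_coords h]
      intro i
      by_cases hi : c i = μ
      · simp only [extend, hi]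
        rw [dif_pos trivial, ← coeComplex_mul, ← coeComplex_mul, mul_comm]
      · simp [extend, hi]
    · intro hw
      change frameMatrix e *ᵥ w ∈ eigenset A μ at hw
      obtain ⟨q, hq⟩ := exists_coords h.frame (frameMatrix e *ᵥ w)
      rw [hq, mem_eigenset_iff_coords h] at hw
      refine ⟨fun i => ⟨(q i).re, (q i).imI⟩, frameMatrix_mulVec_inj he ?_⟩
      rw [hg, hq]
      congr 1
      funext i
      by_cases hi : c i = μ
      · simp only [extend, hi]
        have := hw i
        rw [hi] at this
        rw [dif_pos trivial]
        exact (eq_coeComplex_of_commute hμ.ne' this).symm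
      · simp only [extend, hi]
        by_contra h0
        exact hi (eq_of_similar (h.spectrum.im_nonneg i) hμ.le (Ne.symm h0) (hw i))
  rw [← hrange, LinearMap.finrank_range_of_inj hinj, eigenspace_eq_span_of_diagonal h hμ.le,
    finrank_span_block h.frame, Module.finrank_pi_fintype]
  simp [mul_comm]

theorem mem_coords {e : Fin (n + 1) → Vec n} {S : Submodule ℝ (Vec n)} {w : Vec n} :
    w ∈ coords e S ↔ frameMatrix e *ᵥ w ∈ S := Iff.rfl

theorem isComplexSubspace_coords_eigenset (A : Sp n) (e : Fin (n + 1) → Vec n) (μ : ℂ) :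
    IsComplexSubspace (coords e (eigenset A μ)) := by
  intro w hw
  rw [mem_coords] at *
  rw [mulVec_smul]
  refine smul_mem_eigenset hw ?_
  rw [← coeComplex_mul, ← coeComplex_mul, mul_comm]

/-- The eigensets automatically satisfy the dimension and complexity conditions, so a Grassmann
family exists in the coordinates of any frame. -/
theorem isGrassmannPoint_coords [NeZero n] {A : Sp n} (hA : IsSemisimple A) {k : Kind}
    {e : Fin (n + 1) → Vec n} (he : IsFrame k e) :
    IsGrassmannPoint A e fun μ => coords e (eigenset A μ.1) := by
  intro μ
  refine ⟨⟨?_, isComplexSubspace_coords_eigenset A e μ.1, finrank_coords_eigenset hA he μ.2⟩, rfl⟩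
  intro w hw
  exact Submodule.subset_span (mem_coords.mp hw)

/-! ### The real trace determines the eigenvalues -/

theorem complexPart_mul (A B : Mat n) :
    complexPart (A * B) = complexPart A * complexPart B - (jPart A).map conj * jPart B := by
  ext1 i j
  simp only [complexPart, jPart, mul_apply, map_apply, Matrix.sub_apply, ← Finset.sum_sub_distrib]
  have h1 : (∑ k, A i k * B k j).re = ∑ k, (A i k * B k j).re :=
    map_sum (QuaternionAlgebra.reₗ (-1 : ℝ) 0 (-1)) _ _
  have h2 : (∑ k, A i k * B k j).imI = ∑ k, (A i k * B k j).imI :=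
    map_sum (QuaternionAlgebra.imIₗ (-1 : ℝ) 0 (-1)) _ _
  apply Complex.ext
  · rw [Complex.re_sum]
    refine h1.trans (Finset.sum_congr rfl fun k _ => ?_)
    simp
    ring
  · rw [Complex.im_sum]
    refine h2.trans (Finset.sum_congr rfl fun k _ => ?_)
    simp
    ring

theorem jPart_mul (A B : Mat n) :
    jPart (A * B) = jPart A * complexPart B + (complexPart A).map conj * jPart B := by
  ext1 i j
  simp only [complexPart, jPart, mul_apply, map_apply, Matrix.add_apply, ← Finset.sum_add_distrib]
  have h1 : (∑ k, A i k * B k j).imJ = ∑ k, (A i k * B k j).imJ :=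
    map_sum (QuaternionAlgebra.imJₗ (-1 : ℝ) 0 (-1)) _ _
  have h2 : (∑ k, A i k * B k j).imK = ∑ k, (A i k * B k j).imK :=
    map_sum (QuaternionAlgebra.imKₗ (-1 : ℝ) 0 (-1)) _ _
  apply Complex.ext
  · rw [Complex.re_sum]
    refine h1.trans (Finset.sum_congr rfl fun k _ => ?_)
    simp
    ring
  · rw [Complex.im_sum]
    simp only [h2, ← Finset.sum_neg_distrib]
    refine Finset.sum_congr rfl fun k _ => ?_
    simp
    ring

theorem complexRep_mul (A B : Mat n) : complexRep (A * B) = complexRep A * complexRep B := by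
  have hc : ∀ M N : Matrix (Fin (n + 1)) (Fin (n + 1)) ℂ,
      (M * N).map conj = M.map conj * N.map conj := fun M N => Matrix.map_mul
  have hcc : ∀ M : Matrix (Fin (n + 1)) (Fin (n + 1)) ℂ, (M.map conj).map conj = M := by
    intro M
    ext1 i j
    simp
  have hs : ∀ M N : Matrix (Fin (n + 1)) (Fin (n + 1)) ℂ,
      (M - N).map conj = M.map conj - N.map conj := by
    intro M N
    ext1 i j
    simp
  have ha : ∀ M N : Matrix (Fin (n + 1)) (Fin (n + 1)) ℂ,
      (M + N).map conj = M.map conj + N.map conj := by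
    intro M N
    ext1 i j
    simp
  rw [complexRep, complexRep, complexRep, fromBlocks_multiply, complexPart_mul, jPart_mul]
  congr 1
  · rw [neg_mul, sub_eq_add_neg]
  · rw [ha, hc, hc, hcc, mul_neg, neg_mul]
    abel
  · rw [hs, hc, hc, hcc, mul_neg, sub_eq_add_neg]
    abel

theorem complexRep_diagonal (c : Fin (n + 1) → ℂ) :
    complexRep (diagonal fun i => (c i : ℍ[ℝ])) =
      fromBlocks (diagonal c) 0 0 (diagonal fun i => conj (c i)) := by
  have h1 : complexPart (diagonal fun i => (c i : ℍ[ℝ])) = diagonal c := by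
    ext1 i j
    by_cases h : i = j
    · subst h
      apply Complex.ext <;> simp [complexPart]
    · apply Complex.ext <;> simp [complexPart, h]
  have h2 : jPart (diagonal fun i => (c i : ℍ[ℝ])) = 0 := by
    ext1 i j
    by_cases h : i = j
    · subst h
      apply Complex.ext <;> simp [jPart]
    · apply Complex.ext <;> simp [jPart, h]
  rw [complexRep, h1, h2]
  congr 1
  · ext1 i j
    simp
  · ext1 i j
    by_cases h : i = j
    · subst h
      simp
    · simp [h]

theorem charpoly_complexRep_mul_comm (A B : Mat n) :
    (complexRep (A * B)).charpoly = (complexRep (B * A)).charpoly := by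
  rw [complexRep_mul, complexRep_mul, charpoly_mul_comm]

theorem charpoly_of_diagonalFrame {k : Kind} {A : Sp n} {c : Fin (n + 1) → ℂ}
    {e : Fin (n + 1) → Vec n} (h : IsDiagonalFrame k A c e) :
    (complexRep (mat A)).charpoly =
      ((Finset.univ.val.map c + Finset.univ.val.map fun i => conj (c i)).map
        fun a => Polynomial.X - Polynomial.C a).prod := by
  have h1 : mat A * frameMatrix e = frameMatrix e * diagonal fun i => (c i : ℍ[ℝ]) := by
    rw [mul_frameMatrix]
    ext1 i j
    have := congrFun (mem_eigenset.mp (h.mem j)) i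
    rw [mul_diagonal]
    exact this
  have h2 : mat A = frameMatrix e * ((diagonal fun i => (c i : ℍ[ℝ])) * frameInv k e) := by
    rw [← mul_assoc, ← h1, mul_assoc, mul_frameInv h.frame, mul_one]
  -- Invariance of the characteristic polynomial under cyclic permutation of factors replaces an
  -- explicit similarity of complex matrices.
  rw [h2, charpoly_complexRep_mul_comm, mul_assoc, frameInv_mul h.frame, mul_one,
    complexRep_diagonal, charpoly_fromBlocks_zero₂₁, charpoly_diagonal, charpoly_diagonal,
    Multiset.map_add, Multiset.prod_add, Multiset.map_map, Multiset.map_map]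
  rfl

/-- The real trace lists the coefficients in degrees below `2n + 2`; the leading one is `1`. -/
theorem charpoly_eq_of_realTrace_eq {A A' : Sp n} (h : realTrace A = realTrace A') :
    (complexRep (mat A)).charpoly = (complexRep (mat A')).charpoly := by
  have hdeg : ∀ B : Sp n, (complexRep (mat B)).charpoly.natDegree = 2 * n + 2 := by
    intro B
    rw [charpoly_natDegree_eq_dim, Fintype.card_sum, Fintype.card_fin]
    ring
  ext j
  rcases lt_trichotomy j (2 * n + 2) with hj | rfl | hj
  · exact congrFun h ⟨j, hj⟩
  · have hm := fun B : Sp n => (charpoly_monic (complexRep (mat B))).coeff_natDegree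
    simp only [hdeg] at hm
    rw [hm, hm]
  · rw [Polynomial.coeff_eq_zero_of_natDegree_lt (by rwa [hdeg]),
      Polynomial.coeff_eq_zero_of_natDegree_lt (by rwa [hdeg])]

theorem realTrace_conj (C A : Sp n) : realTrace (C * A * C⁻¹) = realTrace A := by
  have h : (complexRep (mat (C * A * C⁻¹))).charpoly = (complexRep (mat A)).charpoly := by
    have h1 : mat (C * A * C⁻¹) = mat (C * A) * mat C⁻¹ := rfl
    have h2 : mat C⁻¹ * mat (C * A) = mat A := by
      change mat (C⁻¹ * (C * A)) = _
      rw [inv_mul_cancel_left]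
    rw [h1, charpoly_complexRep_mul_comm, h2]
  funext j
  rw [realTrace, realTrace, h]

/-- The roots are the `c i` together with their conjugates. A root in the open upper half plane
comes only from the `c i`, while a real one is counted exactly twice. -/
theorem perm_of_realTrace_eq {k k' : Kind} {A A' : Sp n} {c c' : Fin (n + 1) → ℂ}
    {e e' : Fin (n + 1) → Vec n} (h : IsDiagonalFrame k A c e) (h' : IsDiagonalFrame k' A' c' e')
    (htr : realTrace A = realTrace A') : (List.ofFn c).Perm (List.ofFn c') := by
  have hroots := congrArg Polynomial.roots (charpoly_eq_of_realTrace_eq htr)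
  rw [charpoly_of_diagonalFrame h, charpoly_of_diagonalFrame h',
    Polynomial.roots_multiset_prod_X_sub_C, Polynomial.roots_multiset_prod_X_sub_C] at hroots
  refine perm_ofFn_of_card_eq fun μ => ?_
  classical
  have key : ∀ f : Fin (n + 1) → ℂ, (∀ i, 0 ≤ (f i).im) →
      (Finset.univ.val.map f + Finset.univ.val.map fun i => conj (f i)).count μ =
        Fintype.card {i // f i = μ} + Fintype.card {i // f i = conj μ} := by
    intro f hf
    rw [Multiset.count_add, Multiset.count_map, Multiset.count_map, Fintype.card_subtype,
      Fintype.card_subtype]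
    congr 2
    · simp only [eq_comm]
      rfl
    · refine Multiset.filter_congr fun i _ => ?_
      rw [eq_comm, ← (starRingEnd ℂ).injective.eq_iff, Complex.conj_conj]
  have hcount := congrArg (Multiset.count μ) hroots
  rw [key c h.spectrum.im_nonneg, key c' h'.spectrum.im_nonneg] at hcount
  have hneg : ∀ f : Fin (n + 1) → ℂ, (∀ i, 0 ≤ (f i).im) → ∀ ν : ℂ, ν.im < 0 →
      Fintype.card {i // f i = ν} = 0 := by
    intro f hf ν hν
    rw [Fintype.card_eq_zero_iff]
    refine ⟨fun ⟨i, hi⟩ => ?_⟩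
    have := hf i
    rw [hi] at this
    linarith
  rcases lt_trichotomy μ.im 0 with hμ | hμ | hμ
  · rw [hneg c h.spectrum.im_nonneg μ hμ, hneg c' h'.spectrum.im_nonneg μ hμ]
  · rw [Complex.conj_eq_iff_im.mpr hμ] at hcount
    omega
  · have hμ' : (conj μ).im < 0 := by simpa using hμ
    rw [hneg c h.spectrum.im_nonneg _ hμ', hneg c' h'.spectrum.im_nonneg _ hμ'] at hcount
    omega

/-! ### Block labels -/

/-- In a strict total order (modulus, then argument), an element of a finite set is determined by
the number of its predecessors. -/
theorem eq_of_card_filter_eq {s : Finset ℂ} {z w : ℂ} (hz : z ∈ s) (hw : w ∈ s)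
    (p : ℂ → ℂ → Prop) [∀ a, DecidablePred (p a)]
    (hp : ∀ a b, p a b ↔ ‖b‖ < ‖a‖ ∨ (‖b‖ = ‖a‖ ∧ b.arg < a.arg))
    (h : (s.filter (p z)).card = (s.filter (p w)).card) : z = w := by
  have key : ∀ a ∈ s, ∀ b, p b a → (s.filter (p a)).card < (s.filter (p b)).card := by
    intro a ha b hab
    refine Finset.card_lt_card ⟨fun x hx => ?_, fun hsub => ?_⟩
    · rw [Finset.mem_filter, hp] at hx ⊢
      rw [hp] at hab
      refine ⟨hx.1, ?_⟩
      rcases hx.2 with h1 | ⟨h1, h1'⟩ <;> rcases hab with h2 | ⟨h2, h2'⟩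
      · exact Or.inl (h1.trans h2)
      · exact Or.inl (h2 ▸ h1)
      · exact Or.inl (h1 ▸ h2)
      · exact Or.inr ⟨h1.trans h2, h1'.trans h2'⟩
    · have := (Finset.mem_filter.mp (hsub (Finset.mem_filter.mpr ⟨ha, hab⟩))).2
      rw [hp] at this
      rcases this with h1 | ⟨-, h1⟩ <;> exact lt_irrefl _ h1
  by_contra hne
  rcases lt_trichotomy ‖z‖ ‖w‖ with h1 | h1 | h1
  · exact (key z hz w ((hp _ _).mpr (Or.inl h1))).ne h
  · rcases lt_trichotomy z.arg w.arg with h2 | h2 | h2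
    · exact (key z hz w ((hp _ _).mpr (Or.inr ⟨h1, h2⟩))).ne h
    · exact hne (Complex.ext_norm_arg h1 h2)
    · exact (key w hw z ((hp _ _).mpr (Or.inr ⟨h1.symm, h2⟩))).ne h.symm
  · exact (key w hw z ((hp _ _).mpr (Or.inl h1))).ne h.symm

/-- Allows labels of two different spectra to be compared once their sets of values agree; this is
how the negative class is recovered. -/
theorem eq_of_blockLabel_eq_of_image_eq {c c' : Fin (n + 1) → ℂ}
    (him : Set.range c = Set.range c') {i j : Fin (n + 1)}
    (h : blockLabel c i = blockLabel c' j) : c i = c' j := by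
  classical
  have him' : Finset.univ.image c = Finset.univ.image c' := by
    rw [← Finset.coe_inj]
    simpa using him
  refine eq_of_card_filter_eq (s := Finset.univ.image c) ?_ ?_
    (fun a b => ‖b‖ < ‖a‖ ∨ (‖b‖ = ‖a‖ ∧ b.arg < a.arg)) (fun _ _ => Iff.rfl) ?_
  · exact Finset.mem_image_of_mem c (Finset.mem_univ i)
  · rw [him']
    exact Finset.mem_image_of_mem c' (Finset.mem_univ j)
  · unfold blockLabel at h
    rw [← him'] at h
    convert h

theorem eq_of_blockLabel_eq {c : Fin (n + 1) → ℂ} {i j : Fin (n + 1)}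
    (h : blockLabel c i = blockLabel c j) : c i = c j :=
  eq_of_blockLabel_eq_of_image_eq rfl h

theorem blockLabel_congr {c : Fin (n + 1) → ℂ} {i j : Fin (n + 1)} (h : c i = c j) :
    blockLabel c i = blockLabel c j := by
  unfold blockLabel
  rw [h]

/-! ### Changes of eigenframes -/

theorem IsEigenframe.of_smul {k : Kind} {A : Sp n} {c : Fin (n + 1) → ℂ}
    {e e' : Fin (n + 1) → Vec n} (h : IsEigenframe k A c e) (h' : IsFrame k e')
    (hs : ∀ i, ∃ q : ℍ[ℝ], e' i = op q • e i) : IsEigenframe k A c e' where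
  kind := h.kind
  frame := h'
  spectrum := h.spectrum
  mem i := by
    obtain ⟨q, hq⟩ := hs i
    rw [hq]
    exact Submodule.smul_mem _ _ (h.mem i)

theorem coord_eq_zero_of_mem_span {k : Kind} {e : Fin (n + 1) → Vec n} (h : IsFrame k e)
    {c : Fin (n + 1) → ℂ} {μ : ℂ} {v : Vec n}
    (hv : v ∈ Submodule.span ℍ[ℝ]ᵐᵒᵖ (Set.range fun i : {i // c i = μ} => e i))
    {i : Fin (n + 1)} (hi : c i ≠ μ) : (frameInv k e *ᵥ v) i = 0 := by
  induction hv using Submodule.span_induction with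
  | mem x hx =>
    obtain ⟨⟨j, hj⟩, rfl⟩ := hx
    have hij : i ≠ j := by
      rintro rfl
      exact hi hj
    change (frameInv k e *ᵥ e j) i = 0
    rw [← frameMatrix_mulVec_single e j, mulVec_mulVec, frameInv_mul h, one_mulVec,
      Pi.single_eq_of_ne hij]
  | zero => simp
  | add x y _ _ hx hy => rw [mulVec_add, Pi.add_apply, hx, hy, add_zero]
  | smul a x _ hx => rw [mulVec_smul, Pi.smul_apply, hx, smul_zero]

theorem frame_eq_sum {e e' : Fin (n + 1) → Vec n} {M : Mat n}
    (h : frameMatrix e' = frameMatrix e * M) (j : Fin (n + 1)) :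
    e' j = ∑ i, op (M i j) • e i := by
  rw [← frameMatrix_mulVec_single e' j, h, ← mulVec_mulVec, mulVec_single_one, frameMatrix_mulVec]
  rfl

/-- The eigenframes of an isometry are related by the group of changes of frames. -/
theorem isEigenframe_iff_changeOfFrame [NeZero n] {k : Kind} {A : Sp n} (hA : IsSemisimple A)
    {c : Fin (n + 1) → ℂ} {e e' : Fin (n + 1) → Vec n} (h : IsEigenframe k A c e)
    (h' : IsFrame k e') :
    IsEigenframe k A c e' ↔
      ∃ M ∈ changeOfFrame k (blockLabel c), frameMatrix e' = frameMatrix e * M := by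
  constructor
  · intro he'
    refine ⟨frameInv k e * frameMatrix e', ⟨?_, fun i j hij => ?_⟩, ?_⟩
    · have hF : frameMatrix e * (frameInv k e * frameMatrix e') = frameMatrix e' := by
        rw [← mul_assoc, mul_frameInv h.frame, one_mul]
      have h1 := isFrame_iff.mp he'.frame
      rw [← hF, conjTranspose_mul] at h1
      rw [← isFrame_iff.mp h.frame]
      simp only [mul_assoc] at h1 ⊢
      rw [h1, ← isFrame_iff.mp h.frame, mul_assoc]
    · have hcij : c i ≠ c j := fun hc => hij (blockLabel_congr hc)
      have hmem := he'.mem j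
      -- The `j`-th column of the change of frame holds the coordinates of `e' j`, which lies in the
      -- span of its block.
      rw [eigenspace_eq_span hA h (h.spectrum.im_nonneg j)] at hmem
      rw [← coord_eq_zero_of_mem_span h.frame hmem hcij]
      rfl
    · rw [← mul_assoc, mul_frameInv h.frame, one_mul]
  · rintro ⟨M, ⟨-, hM⟩, hMe⟩
    refine ⟨h.kind, h', h.spectrum, fun j => ?_⟩
    rw [frame_eq_sum hMe j]
    refine Submodule.sum_mem _ fun i _ => ?_
    by_cases hij : blockLabel c i = blockLabel c j
    · rw [← eq_of_blockLabel_eq hij]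
      exact Submodule.smul_mem _ _ (h.mem i)
    · simp [hM i j hij]

/-! ### Existence of eigenframes of a pair -/

theorem haveCommonFixedPoint_of_eq_smul [NeZero n] {A B : Sp n} {c d : Fin (n + 1) → ℂ}
    {e f : Fin (n + 1) → Vec n} (he : IsDiagonalFrame .hyperbolic A c e)
    (hf : IsDiagonalFrame .hyperbolic B d f) {i j : Fin (n + 1)} (hi : i = 0 ∨ i = 1)
    {q : ℍ[ℝ]} (h : e i = op q • f j) : HaveCommonFixedPoint A B := by
  have h0 := frame_ne_zero he.frame i
  have hnull : herm (e i) (e i) = 0 := by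
    have h01 := zero_ne_one_fin n
    rcases hi with rfl | rfl <;> simp [he.frame _ _, gramMatrix, h01, h01.symm]
  refine ⟨⟨Projectivization.mk ℍ[ℝ]ᵐᵒᵖ (e i) h0, Or.inr ⟨_, h0, rfl, by simp [hnull]⟩⟩,
    Subtype.ext ?_, Subtype.ext ?_⟩
  · exact (smul_mk_eq_iff h0).mpr ⟨_, mem_eigenset.mp (he.mem i)⟩
  · change B • Projectivization.mk ℍ[ℝ]ᵐᵒᵖ (e i) h0 = Projectivization.mk ℍ[ℝ]ᵐᵒᵖ (e i) h0
    have hj := frame_ne_zero hf.frame j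
    rw [(mk_eq_mk_iff_op h0 hj).mpr ⟨q, h⟩]
    exact (smul_mk_eq_iff hj).mpr ⟨_, mem_eigenset.mp (hf.mem j)⟩

/-- The family `(a p, r q, x₁, …)`. -/
def rescale (p q : ℍ[ℝ]) (e : Fin (n + 1) → Vec n) (i : Fin (n + 1)) : Vec n :=
  if i = 0 then op p • e i else if i = 1 then op q • e i else e i

theorem exists_rescale_eq_smul (p q : ℍ[ℝ]) (e : Fin (n + 1) → Vec n) (i : Fin (n + 1)) :
    ∃ x : ℍ[ℝ], rescale p q e i = op x • e i := by
  unfold rescale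
  split_ifs
  · exact ⟨_, rfl⟩
  · exact ⟨_, rfl⟩
  · exact ⟨1, by simp⟩

theorem isFrame_rescale [NeZero n] {p q : ℍ[ℝ]} (hqp : star q * p = 1)
    {e : Fin (n + 1) → Vec n} (h : IsFrame .hyperbolic e) :
    IsFrame .hyperbolic (rescale p q e) := by
  have hpq : star p * q = 1 := by simpa using congrArg star hqp
  have h01 := zero_ne_one_fin n
  intro i j
  rw [← h i j]
  by_cases hi0 : i = 0
  · subst hi0
    by_cases hj0 : j = 0
    · subst hj0
      simp [rescale, herm_op_left, herm_op_right, h _ _, gramMatrix, h01]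
    by_cases hj1 : j = 1
    · subst hj1
      simp [rescale, herm_op_left, herm_op_right, h _ _, gramMatrix, h01.symm, hqp]
    · simp [rescale, herm_op_left, h _ _, gramMatrix, hj0, hj1, Ne.symm hj0]
  by_cases hi1 : i = 1
  · subst hi1
    by_cases hj0 : j = 0
    · subst hj0
      simp [rescale, herm_op_left, herm_op_right, h _ _, gramMatrix, h01.symm, hpq]
    by_cases hj1 : j = 1
    · subst hj1
      simp [rescale, herm_op_left, herm_op_right, h _ _, gramMatrix, h01.symm]
    · simp [rescale, herm_op_left, h _ _, gramMatrix, hj0, hj1, Ne.symm hj1, h01.symm]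
  · by_cases hj0 : j = 0
    · subst hj0
      simp [rescale, herm_op_right, h _ _, gramMatrix, hi0, hi1]
    by_cases hj1 : j = 1
    · subst hj1
      simp [rescale, herm_op_right, h _ _, gramMatrix, hi0, hi1, h01.symm]
    · simp [rescale, hi0, hi1, hj0, hj1]

/-- Only two hyperbolic frames need work: a repelling point of `A` equal to an attracting point of
`B` would be a common fixed point, so `q = ⟨r,a'⟩` is nonzero. Replacing `(a', r')` by `(a' q̄⁻¹, r'
q)` gives `⟨r,a'⟩ = 1` and keeps the frame relations. -/
theorem exists_isEigenframeOf [NeZero n] {A B : Sp n} (hA : IsSemisimple A) (hB : IsSemisimple B)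
    (hAB : ¬ HaveCommonFixedPoint A B) :
    ∃ (E : FramePair n) (c d : Fin (n + 1) → ℂ), E.IsEigenframeOf A B c d := by
  obtain ⟨k, c, e, he⟩ := exists_diagonalFrame hA
  obtain ⟨l, d, f, hf⟩ := exists_diagonalFrame hB
  by_cases hkl : k = .hyperbolic ∧ l = .hyperbolic
  · obtain ⟨rfl, rfl⟩ := hkl
    have h01 := zero_ne_one_fin n
    have hq : herm (e 1) (f 0) ≠ 0 := by
      intro h
      obtain ⟨q, hq⟩ := exists_smul_of_null_of_orthogonal
        (by simp [hf.frame 0 0, gramMatrix, h01]) (by simp [he.frame 1 1, gramMatrix, h01.symm])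
        (frame_ne_zero hf.frame 0) (herm_comm_zero h)
      exact hAB (haveCommonFixedPoint_of_eq_smul he hf (Or.inr rfl) hq)
    set q := herm (e 1) (f 0) with hqdef
    have hqq : star q * (star q)⁻¹ = 1 := mul_inv_cancel₀ (star_ne_zero.mpr hq)
    refine ⟨⟨.hyperbolic, .hyperbolic, e, rescale (star q)⁻¹ q f, he.frame, isFrame_rescale hqq hf.frame,
      fun _ _ i j hi _ x hx => ?_, fun _ _ => ?_⟩, c, d, he.isEigenframe,
      hf.isEigenframe.of_smul (isFrame_rescale hqq hf.frame) (exists_rescale_eq_smul _ q f)⟩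
    · obtain ⟨p, hp⟩ := exists_rescale_eq_smul _ q f j
      rw [hp, smul_smul, ← op_mul] at hx
      exact hAB (haveCommonFixedPoint_of_eq_smul he hf hi hx)
    · simp only [rescale, if_true]
      rw [herm_op_right, star_inv₀, star_star, ← hqdef, inv_mul_cancel₀ hq]
  · exact ⟨⟨k, l, e, f, he.frame, hf.frame, fun h1 h2 => absurd ⟨h1, h2⟩ hkl,
      fun h1 h2 => absurd ⟨h1, h2⟩ hkl⟩, c, d, he.isEigenframe, hf.isEigenframe⟩

/-! ### Frames with the same associated points -/

/-- If `x₁` is scaled by `p` and `√2 x₁ + x_j` by `q`, pairing the latter with the new `x₁` gives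
`p̄ q = 1 = p̄ p`. So `q = p`, and subtracting `√2 x₁` shows that `x_j` is scaled by `p` too. -/
theorem eq_smul_of_assocVec_elliptic {e e' : Fin (n + 1) → Vec n} (he : IsFrame .elliptic e)
    (he' : IsFrame .elliptic e')
    (h : ∀ l, ∃ q : ℍ[ℝ], assocVec .elliptic e' l = op q • assocVec .elliptic e l)
    (i : Fin (n + 1)) : ∃ q : ℍ[ℝ], e' i = op q • e i := by
  by_cases hi : i = 0
  · subst hi
    simpa [assocVec] using h 0
  obtain ⟨p, hp⟩ := h 0
  obtain ⟨q, hq⟩ := h i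
  simp only [assocVec, if_true, hi, if_false] at hp hq
  have hpp : star p * p = 1 := by
    have h1 := he' 0 0
    rw [hp, herm_op_left, herm_op_right, he] at h1
    simpa [gramMatrix] using h1
  have hpq : star p * q = 1 := by
    have h1 := congrArg (fun v => herm v (e' 0)) hq
    simp only [herm_add_left, herm_smul_left, herm_op_left, he' _ _] at h1
    rw [hp] at h1
    simp only [herm_op_right, he _ _] at h1
    simp [gramMatrix, hi] at h1
    exact h1.symm
  have hp0 : star p ≠ 0 := by
    intro h0
    rw [h0, zero_mul] at hpp
    exact zero_ne_one hpp
  have hqp : q = p := mul_left_cancel₀ hp0 (hpq.trans hpp.symm)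
  refine ⟨p, ?_⟩
  rw [hqp, hp, smul_add, smul_comm] at hq
  exact add_left_cancel hq

/-- Pairing the lift `(a - r)/√2 + x_l` with the new `a` and the new `r` shows that `a`, `r` and the
lift are scaled by the same quaternion; hence `x_l` is as well. -/
theorem eq_smul_of_assocVec_hyperbolic [NeZero n] {e e' : Fin (n + 1) → Vec n}
    (he : IsFrame .hyperbolic e) (he' : IsFrame .hyperbolic e')
    (h : ∀ l, ∃ q : ℍ[ℝ], assocVec .hyperbolic e' l = op q • assocVec .hyperbolic e l)
    (i : Fin (n + 1)) : ∃ q : ℍ[ℝ], e' i = op q • e i := by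
  have h01 := zero_ne_one_fin n
  by_cases hi0 : i = 0
  · subst hi0
    simpa [assocVec] using h 0
  by_cases hi1 : i = 1
  · subst hi1
    simpa [assocVec, h01.symm] using h 1
  obtain ⟨p, hp⟩ := h 0
  obtain ⟨r, hr⟩ := h 1
  obtain ⟨q, hq⟩ := h i
  simp only [assocVec, if_true, h01.symm, hi0, hi1, if_false] at hp hr hq
  have hrp : star r * p = 1 := by
    have h1 := he' 0 1
    rw [hp, hr, herm_op_left, herm_op_right, he] at h1
    simpa [gramMatrix] using h1
  have hpr : star p * r = 1 := by
    have := congrArg star hrp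
    simpa using this
  have hpq : star p * q = 1 := by
    have h1 := congrArg (fun v => herm v (e' 0)) hq
    simp only [herm_add_left, herm_sub_left, herm_smul_left, herm_op_left, he' _ _] at h1
    rw [hp] at h1
    simp only [herm_op_right, he _ _] at h1
    simp only [gramMatrix, of_apply, h01, h01.symm, hi0, hi1] at h1
    simp at h1
    exact h1.symm
  have hrq : star r * q = 1 := by
    have h1 := congrArg (fun v => herm v (e' 1)) hq
    simp only [herm_add_left, herm_sub_left, herm_smul_left, herm_op_left, he' _ _] at h1
    rw [hr] at h1
    simp only [herm_op_right, he _ _] at h1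
    simp only [gramMatrix, of_apply, h01, h01.symm, hi0, hi1] at h1
    simp at h1
    exact h1.symm
  have hp0 : star p ≠ 0 := fun h0 => by simp [h0] at hpr
  have hr0 : star r ≠ 0 := fun h0 => by simp [h0] at hrp
  have hqr : q = r := mul_left_cancel₀ hp0 (hpq.trans hpr.symm)
  have hqp : q = p := mul_left_cancel₀ hr0 (hrq.trans hrp.symm)
  refine ⟨q, ?_⟩
  rw [hp, hr, ← hqr, ← hqp, ← smul_sub, smul_add, smul_comm] at hq
  exact add_left_cancel hq

theorem eq_smul_of_assocVec [NeZero n] {k : Kind} {e e' : Fin (n + 1) → Vec n} (he : IsFrame k e)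
    (he' : IsFrame k e') (h : ∀ l, ∃ q : ℍ[ℝ], assocVec k e' l = op q • assocVec k e l)
    (i : Fin (n + 1)) : ∃ q : ℍ[ℝ], e' i = op q • e i := by
  cases k
  · exact eq_smul_of_assocVec_hyperbolic he he' h i
  · exact eq_smul_of_assocVec_elliptic he he' h i

/-! ### Translates of frames -/

theorem IsFrame.translate {k : Kind} {e : Fin (n + 1) → Vec n} (h : IsFrame k e) (C : Sp n) :
    IsFrame k fun i => C • e i := fun i j => by rw [herm_smul_smul, h]

theorem mul_smul_vec (A B : Sp n) (v : Vec n) : (A * B) • v = A • B • v := mul_smul A B v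

theorem inv_smul_smul_vec (A : Sp n) (v : Vec n) : A⁻¹ • A • v = v := inv_smul_smul A v

theorem smul_real_smul (C : Sp n) (r : ℝ) (v : Vec n) : C • r • v = r • C • v := by
  rw [smul_vec, smul_vec, mulVec_smul]

theorem assocVec_translate (k : Kind) (C : Sp n) (e : Fin (n + 1) → Vec n) (l : Fin (n + 1)) :
    assocVec k (fun i => C • e i) l = C • assocVec k e l := by
  cases k <;> simp only [assocVec] <;> split_ifs <;>
    simp only [smul_add, smul_sub, smul_real_smul]

theorem frameMatrix_translate (C : Sp n) (e : Fin (n + 1) → Vec n) (w : Vec n) :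
    (frameMatrix fun i => C • e i) *ᵥ w = C • (frameMatrix e *ᵥ w) := by
  have h : (frameMatrix fun i => C • e i) = mat C * frameMatrix e := (mul_frameMatrix _ _).symm
  rw [h, smul_vec, mulVec_mulVec]

/-- The image of a pair of frames under an isometry. -/
def FramePair.translate (C : Sp n) (E : FramePair n) : FramePair n where
  kind₁ := E.kind₁
  kind₂ := E.kind₂
  frame₁ i := C • E.frame₁ i
  frame₂ i := C • E.frame₂ i
  isFrame₁ := E.isFrame₁.translate C
  isFrame₂ := E.isFrame₂.translate C
  disjoint h1 h2 i j hi hj q h := by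
    refine E.disjoint h1 h2 i j hi hj q ?_
    rw [← smul_comm C (op q)] at h
    exact smul_left_cancel C h
  normalized h1 h2 := by rw [herm_smul_smul, E.normalized h1 h2]

theorem FramePair.points_translate [NeZero n] (C : Sp n) (E : FramePair n) :
    (E.translate C).points = C • E.points := by
  funext l
  have key : ∀ {k : Kind} {e : Fin (n + 1) → Vec n} (h : IsFrame k e) (l : Fin (n + 1)),
      assocPoint (h.translate C) l = C • assocPoint h l := by
    intro k e h l
    apply Subtype.ext
    change Projectivization.mk ℍ[ℝ]ᵐᵒᵖ _ _ = Projectivization.mk ℍ[ℝ]ᵐᵒᵖ (C • assocVec k e l) _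
    simp only [assocVec_translate]
  cases l with
  | inl l => exact key E.isFrame₁ l
  | inr l => exact key E.isFrame₂ l

theorem FramePair.place_translate [NeZero n] (C : Sp n) (E : FramePair n)
    (b₁ b₂ : Fin (n + 1) → ℕ) : (E.translate C).place b₁ b₂ = E.place b₁ b₂ := by
  refine Prod.ext rfl (Quotient.sound ?_)
  change (E.translate C).points ∈ MulAction.orbit (Sp n) E.points
  rw [FramePair.points_translate]
  exact MulAction.mem_orbit _ _

theorem exists_smul_of_assocPoint_eq [NeZero n] {k k' : Kind} {e e' : Fin (n + 1) → Vec n}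
    (he : IsFrame k e) (he' : IsFrame k' e') {C : Sp n} {l : Fin (n + 1)}
    (h : C • assocPoint he' l = assocPoint he l) :
    ∃ q : ℍ[ℝ], C • assocVec k' e' l = op q • assocVec k e l :=
  (mk_eq_mk_iff_op ((smul_ne_zero_iff_ne C).mpr (assocVec_ne_zero he' l))
    (assocVec_ne_zero he l)).mp (congrArg Subtype.val h)

theorem IsEigenframe.of_assocPoint_eq [NeZero n] {k k' : Kind} (hk : k' = k) {A : Sp n}
    {c : Fin (n + 1) → ℂ} {e e' : Fin (n + 1) → Vec n} (he : IsEigenframe k A c e)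
    (he' : IsFrame k' e') {C : Sp n}
    (h : ∀ l, C • assocPoint he' l = assocPoint he.frame l) :
    IsEigenframe k' A c fun i => C • e' i := by
  subst hk
  refine he.of_smul (he'.translate C) (eq_smul_of_assocVec he.frame (he'.translate C) fun l => ?_)
  rw [assocVec_translate]
  exact exists_smul_of_assocPoint_eq he.frame he' (h l)

/-- A pair of frames whose place lies in the canonical orbit is congruent to an eigenframe. -/
theorem exists_translate_of_place_mem [NeZero n] {A B : Sp n} {R : FramePair n}
    {b₁ b₂ : Fin (n + 1) → ℕ} (h : R.place b₁ b₂ ∈ canonicalOrbit A B) :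
    ∃ (C : Sp n) (c d : Fin (n + 1) → ℂ), (R.translate C).IsEigenframeOf A B c d ∧
      b₁ = blockLabel c ∧ b₂ = blockLabel d := by
  obtain ⟨E, c, d, ⟨hE₁, hE₂⟩, hplace⟩ := h
  obtain ⟨htype, hpts⟩ := Prod.ext_iff.mp hplace
  have hk₁ : R.kind₁ = E.kind₁ := congrArg PairType.kind₁ htype
  have hk₂ : R.kind₂ = E.kind₂ := congrArg PairType.kind₂ htype
  have hrel : E.points ∈ MulAction.orbit (Sp n) R.points :=
    (MulAction.orbitRel_apply).mp (Quotient.exact hpts.symm)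
  obtain ⟨C, hC⟩ := hrel
  refine ⟨C, c, d, ⟨?_, ?_⟩, congrArg PairType.mult₁ htype, congrArg PairType.mult₂ htype⟩
  · exact hE₁.of_assocPoint_eq hk₁ R.isFrame₁ fun l => congrFun hC (Sum.inl l)
  · exact hE₂.of_assocPoint_eq hk₂ R.isFrame₂ fun l => congrFun hC (Sum.inr l)

/-! ### Canonical orbits and points on the eigenvalue Grassmannians -/

/-- Kinds and spectra are the same for all eigenframes, and the eigenframes form one orbit of the
changes of frames, so any single eigenframe presents the canonical orbit. -/
theorem canonicalOrbit_eq [NeZero n] {A B : Sp n} (hA : IsSemisimple A) (hB : IsSemisimple B)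
    {E : FramePair n} {c d : Fin (n + 1) → ℂ} (hE : E.IsEigenframeOf A B c d) :
    canonicalOrbit A B = {x | ∃ E' : FramePair n, E.Related (blockLabel c) (blockLabel d) E' ∧
      x = E'.place (blockLabel c) (blockLabel d)} := by
  have key : ∀ {k k' : Kind} {D : Sp n} (_ : IsSemisimple D) {f : Fin (n + 1) → ℂ}
      {e e' : Fin (n + 1) → Vec n} (_ : IsEigenframe k D f e) (_ : IsFrame k' e') (_ : k' = k),
      IsEigenframe k' D f e' ↔
        ∃ M ∈ changeOfFrame k (blockLabel f), frameMatrix e' = frameMatrix e * M := by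
    intro k k' D hD f e e' he he' hk
    subst hk
    exact isEigenframe_iff_changeOfFrame hD he he'
  ext x
  constructor
  · rintro ⟨E', c', d', ⟨h1, h2⟩, rfl⟩
    obtain ⟨hk₁, rfl⟩ := h1.unique hA hE.1
    obtain ⟨hk₂, rfl⟩ := h2.unique hB hE.2
    exact ⟨E', ⟨hk₁, hk₂, (key hA hE.1 E'.isFrame₁ hk₁).mp h1,
      (key hB hE.2 E'.isFrame₂ hk₂).mp h2⟩, rfl⟩
  · rintro ⟨E', ⟨hk₁, hk₂, h1, h2⟩, rfl⟩
    exact ⟨E', c, d, ⟨(key hA hE.1 E'.isFrame₁ hk₁).mpr h1,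
      (key hB hE.2 E'.isFrame₂ hk₂).mpr h2⟩, rfl⟩

theorem canonicalOrbit_mem_QL [NeZero n] {A B : Sp n} (hA : IsSemisimple A) (hB : IsSemisimple B)
    (hAB : ¬ HaveCommonFixedPoint A B) : canonicalOrbit A B ∈ QL n := by
  obtain ⟨E, c, d, hE⟩ := exists_isEigenframeOf hA hB hAB
  exact ⟨E, blockLabel c, blockLabel d, ⟨c, hE.1.spectrum, rfl⟩, ⟨d, hE.2.spectrum, rfl⟩,
    canonicalOrbit_eq hA hB hE⟩

/-- The reference pair has its place in the canonical orbit, so a translate of it is an eigenframe,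
and the eigensets can be read in its coordinates. -/
theorem grassmannPoints_nonempty [NeZero n] {A B : Sp n} (hA : IsSemisimple A)
    (hB : IsSemisimple B) (hAB : ¬ HaveCommonFixedPoint A B)
    {ρ : Set (PairType n × Moduli n) → FramePair n} (hρ : IsReference ρ) :
    (grassmannPoints ρ A B).Nonempty := by
  obtain ⟨b₁, b₂, h⟩ := hρ _ (canonicalOrbit_mem_QL hA hB hAB)
  obtain ⟨C, c, d, hE, -, -⟩ := exists_translate_of_place_mem h
  exact ⟨⟨_, _⟩, _, c, d, C, hE, ⟨rfl, rfl, fun _ => rfl, fun _ => rfl⟩,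
    isGrassmannPoint_coords hA hE.1.frame, isGrassmannPoint_coords hB hE.2.frame⟩

/-! ### Invariance under conjugation -/

theorem smul_mem_eigenset_conj {C A : Sp n} {μ : ℂ} {v : Vec n} :
    C • v ∈ eigenset (C * A * C⁻¹) μ ↔ v ∈ eigenset A μ := by
  rw [mem_eigenset, mem_eigenset, mul_smul_vec, inv_smul_smul_vec, mul_smul_vec, ← smul_comm C]
  exact ⟨fun h => smul_left_cancel C h, fun h => by rw [h]⟩

theorem smul_mem_eigenspace_conj {C A : Sp n} {μ : ℂ} {v : Vec n} (hv : v ∈ eigenspace A μ) :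
    C • v ∈ eigenspace (C * A * C⁻¹) μ := by
  have h := Submodule.mem_map_of_mem (f := DistribSMul.toLinearMap ℍ[ℝ]ᵐᵒᵖ (Vec n) C) hv
  rw [eigenspace, Submodule.map_span] at h
  refine Submodule.span_mono ?_ h
  rintro _ ⟨x, hx, rfl⟩
  exact smul_mem_eigenset_conj.mpr hx

theorem coords_conj (C A : Sp n) (e : Fin (n + 1) → Vec n) (μ : ℂ) :
    coords (fun i => C • e i) (eigenset (C * A * C⁻¹) μ) = coords e (eigenset A μ) := by
  ext w
  rw [mem_coords, mem_coords, frameMatrix_translate, smul_mem_eigenset_conj]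

/-- The kind of the conjugate is obtained from a translated diagonal frame, which avoids
transporting the fixed-point conditions. -/
theorem IsEigenframe.conj [NeZero n] {A : Sp n} (hA : IsSemisimple A) {k : Kind}
    {c : Fin (n + 1) → ℂ} {e : Fin (n + 1) → Vec n} (h : IsEigenframe k A c e) (C : Sp n) :
    IsEigenframe k (C * A * C⁻¹) c fun i => C • e i := by
  obtain ⟨k', c', e', h'⟩ := exists_diagonalFrame hA
  obtain ⟨rfl, rfl⟩ := h.unique hA h'.isEigenframe
  have hC : IsDiagonalFrame k (C * A * C⁻¹) c fun i => C • e' i :=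
    ⟨h'.frame.translate C, h.spectrum, fun i => smul_mem_eigenset_conj.mpr (h'.mem i)⟩
  exact ⟨hC.kind_matches, h.frame.translate C, h.spectrum,
    fun i => smul_mem_eigenspace_conj (h.mem i)⟩

theorem canonicalOrbit_conj_subset [NeZero n] {A B : Sp n} (hA : IsSemisimple A)
    (hB : IsSemisimple B) (C : Sp n) :
    canonicalOrbit A B ⊆ canonicalOrbit (C * A * C⁻¹) (C * B * C⁻¹) := by
  rintro _ ⟨E, c, d, ⟨h1, h2⟩, rfl⟩
  exact ⟨E.translate C, c, d, ⟨h1.conj hA C, h2.conj hB C⟩, (E.place_translate C _ _).symm⟩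

/-- Translating the frame along with the isometry leaves coordinates unchanged, and equality of the
orbits keeps the reference pair the same. -/
theorem grassmannPoints_conj_subset [NeZero n] {A B : Sp n} (hA : IsSemisimple A)
    (hB : IsSemisimple B) (C : Sp n) (hA' : IsSemisimple (C * A * C⁻¹))
    (hB' : IsSemisimple (C * B * C⁻¹)) (ρ : Set (PairType n × Moduli n) → FramePair n)
    (hO : canonicalOrbit A B = canonicalOrbit (C * A * C⁻¹) (C * B * C⁻¹)) :
    grassmannPoints ρ A B ⊆ grassmannPoints ρ (C * A * C⁻¹) (C * B * C⁻¹) := by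
  rintro γ ⟨E, c, d, C₀, ⟨h1, h2⟩, ⟨t1, t2, t3, t4⟩, g1, g2⟩
  have key : ∀ {D : Sp n} (_ : IsSemisimple (C * D * C⁻¹)) {k : Kind} {e : Fin (n + 1) → Vec n}
      (_ : IsFrame k e) {δ : GrassmannData n}, IsGrassmannPoint D e δ →
      IsGrassmannPoint (C * D * C⁻¹) (fun i => C • e i) δ := by
    intro D hD k e he δ hδ
    have := isGrassmannPoint_coords hD (he.translate C)
    simp only [coords_conj] at this
    have hδ' : δ = fun μ => coords e (eigenset D μ.1) := funext fun μ => (hδ μ).2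
    rwa [hδ']
  refine ⟨E.translate C, c, d, C * C₀, ⟨h1.conj hA C, h2.conj hB C⟩, ?_,
    key hA' h1.frame g1, key hB' h2.frame g2⟩
  rw [← hO]
  refine ⟨t1, t2, fun i => ?_, fun i => ?_⟩
  · rw [mul_smul_vec, ← t3]
    rfl
  · rw [mul_smul_vec, ← t4]
    rfl

/-! ### Reconstruction of the pair -/

theorem smul_eq_of_mem_eigenspace_of_im_eq_zero {A : Sp n} {μ : ℂ} (hμ : μ.im = 0) {v : Vec n}
    (hv : v ∈ eigenspace A μ) : A • v = op (μ : ℍ[ℝ]) • v := by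
  have hcomm : ∀ q : ℍ[ℝ], (μ : ℍ[ℝ]) * q = q * (μ : ℍ[ℝ]) := by
    intro q
    ext <;> simp [hμ, mul_comm]
  induction hv using Submodule.span_induction with
  | mem x hx => exact hx
  | zero => simp
  | add x y _ _ hx hy => rw [smul_add, hx, hy, smul_add]
  | smul a x _ hx =>
    rw [← op_unop a, smul_comm, hx, smul_smul, smul_smul, ← op_mul, ← op_mul, hcomm]

theorem eq_of_smul_frame_eq {k : Kind} {e : Fin (n + 1) → Vec n} (he : IsFrame k e) {A B : Sp n}
    (h : ∀ i, A • e i = B • e i) : A = B := by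
  have h1 : mat A * frameMatrix e = mat B * frameMatrix e := by
    rw [mul_frameMatrix, mul_frameMatrix]
    exact congrArg frameMatrix (funext h)
  have h2 := congrArg (fun M => M * frameInv k e) h1
  simp only [mul_assoc, mul_frameInv he, mul_one] at h2
  exact Subtype.ext (Units.ext h2)

/-- An isometry is determined by an eigenframe, the eigenvalues, and the eigensets of the non-real
eigenvalues in the coordinates of the eigenframe. -/
theorem conj_eq_of_eigenframe {k : Kind} {A A' K : Sp n} {c : Fin (n + 1) → ℂ}
    {e : Fin (n + 1) → Vec n} (h : IsEigenframe k A c e)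
    (h' : IsEigenframe k A' c fun i => K • e i)
    (hγ : ∀ μ : ℂ, 0 < μ.im →
      coords e (eigenset A μ) = coords (fun i => K • e i) (eigenset A' μ)) :
    K * A * K⁻¹ = A' := by
  rw [mul_inv_eq_iff_eq_mul]
  refine eq_of_smul_frame_eq h.frame fun i => ?_
  rw [mul_smul_vec, mul_smul_vec]
  rcases (h.spectrum.im_nonneg i).eq_or_lt with hi | hi
  · rw [smul_eq_of_mem_eigenspace_of_im_eq_zero hi.symm (h.mem i),
      smul_eq_of_mem_eigenspace_of_im_eq_zero hi.symm (h'.mem i), smul_comm]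
  · have hspan : ∀ v ∈ eigenspace A (c i), K • A • v = A' • K • v := by
      intro v hv
      induction hv using Submodule.span_induction with
      | mem x hx =>
        obtain ⟨q, rfl⟩ := exists_coords h.frame x
        -- Equality of coordinates says that `K` maps the eigenset of `A` to that of `A'`; on it
        -- both isometries act by the same right scalar.
        have hq : q ∈ coords e (eigenset A (c i)) := hx
        rw [hγ _ hi, mem_coords, frameMatrix_translate] at hq
        rw [mem_eigenset.mp hq, mem_eigenset.mp hx, smul_comm]
      | zero => simp
      | add x y _ _ hx hy => simp only [smul_add, hx, hy]
      | smul a x _ hx => rw [smul_comm A a, smul_comm K a, hx, smul_comm K a, smul_comm A' a]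
    exact hspan _ (h.mem i)

/-- Eigenvalues are determined by the real trace together with the kind and the multiplicity. -/
theorem eigenvalues_eq [NeZero n] {A A' : Sp n} (hA : IsSemisimple A) (hA' : IsSemisimple A')
    {k : Kind} {c c' : Fin (n + 1) → ℂ} {e e' : Fin (n + 1) → Vec n} (h : IsEigenframe k A c e)
    (h' : IsEigenframe k A' c' e') (htr : realTrace A = realTrace A')
    (hb : blockLabel c = blockLabel c') : c = c' := by
  obtain ⟨l, d, f, hf⟩ := exists_diagonalFrame hA
  obtain ⟨l', d', f', hf'⟩ := exists_diagonalFrame hA'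
  obtain ⟨rfl, rfl⟩ := h.unique hA hf.isEigenframe
  obtain ⟨rfl, rfl⟩ := h'.unique hA' hf'.isEigenframe
  have hp := perm_of_realTrace_eq hf hf' htr
  refine h.spectrum.eq_of_perm h'.spectrum hp fun _ => ?_
  -- In the elliptic case the label of the first vector singles out the negative class.
  refine eq_of_blockLabel_eq_of_image_eq ?_ (congrFun hb 0)
  ext z
  exact List.mem_ofFn.symm.trans (hp.mem_iff.trans List.mem_ofFn)

/-- A common Grassmann family comes with eigenframes `C ρ(O)` and `C' ρ(O)` over the same reference
pair, so `C' C⁻¹` is the conjugating isometry for both components. -/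
theorem pairConj_of_invariants_eq [NeZero n] {A B A' B' : Sp n} (hA : IsSemisimple A)
    (hB : IsSemisimple B) (hA' : IsSemisimple A') (hB' : IsSemisimple B')
    {ρ : Set (PairType n × Moduli n) → FramePair n} (htA : realTrace A = realTrace A')
    (htB : realTrace B = realTrace B') (hO : canonicalOrbit A B = canonicalOrbit A' B')
    (hG : (grassmannPoints ρ A B ∩ grassmannPoints ρ A' B').Nonempty) : PairConj A B A' B' := by
  obtain ⟨γ, ⟨E, c, d, C, hE, ⟨t1, t2, t3, t4⟩, g1, g2⟩,
    ⟨E', c', d', C', hE', ⟨t1', t2', t3', t4'⟩, g1', g2'⟩⟩ := hG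
  rw [← hO] at t1' t2' t3' t4'
  -- Equality of the orbits is used a second time, to compare the multiplicities of the two pairs.
  have hmem : E.place (blockLabel c) (blockLabel d) ∈ canonicalOrbit A' B' := by
    rw [← hO]
    exact ⟨E, c, d, hE, rfl⟩
  obtain ⟨D, c'', d'', hE'', hbc, hbd⟩ := exists_translate_of_place_mem hmem
  obtain ⟨-, rfl⟩ := hE''.1.unique hA' hE'.1
  obtain ⟨-, rfl⟩ := hE''.2.unique hB' hE'.2
  have h1 := hE'.1
  have h2 := hE'.2
  rw [t1', ← t1] at h1
  rw [t2', ← t2] at h2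
  obtain rfl := eigenvalues_eq hA hA' hE.1 h1 htA hbc
  obtain rfl := eigenvalues_eq hB hB' hE.2 h2 htB hbd
  have f1 : E'.frame₁ = fun i => (C' * C⁻¹) • E.frame₁ i := by
    funext i
    rw [t3', t3, mul_smul_vec, inv_smul_smul_vec]
  have f2 : E'.frame₂ = fun i => (C' * C⁻¹) • E.frame₂ i := by
    funext i
    rw [t4', t4, mul_smul_vec, inv_smul_smul_vec]
  rw [f1] at h1 g1'
  rw [f2] at h2 g2'
  exact ⟨C' * C⁻¹,
    conj_eq_of_eigenframe hE.1 h1 fun μ hμ => (g1 ⟨μ, hμ⟩).2.symm.trans (g1' ⟨μ, hμ⟩).2,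
    conj_eq_of_eigenframe hE.2 h2 fun μ hμ => (g2 ⟨μ, hμ⟩).2.symm.trans (g2' ⟨μ, hμ⟩).2⟩

theorem invariants_eq_of_pairConj [NeZero n] {A B A' B' : Sp n} (hA : IsSemisimple A)
    (hB : IsSemisimple B) (hA' : IsSemisimple A') (hB' : IsSemisimple B')
    (ρ : Set (PairType n × Moduli n) → FramePair n) (h : PairConj A B A' B') :
    realTrace A = realTrace A' ∧ realTrace B = realTrace B' ∧
      canonicalOrbit A B = canonicalOrbit A' B' ∧
      grassmannPoints ρ A B = grassmannPoints ρ A' B' := by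
  obtain ⟨C, rfl, rfl⟩ := h
  have hback : ∀ D : Sp n, C⁻¹ * (C * D * C⁻¹) * C⁻¹⁻¹ = D := fun D => by group
  have hO : canonicalOrbit A B = canonicalOrbit (C * A * C⁻¹) (C * B * C⁻¹) := by
    refine (canonicalOrbit_conj_subset hA hB C).antisymm ?_
    have := canonicalOrbit_conj_subset hA' hB' C⁻¹
    rwa [hback, hback] at this
  refine ⟨(realTrace_conj C A).symm, (realTrace_conj C B).symm, hO, ?_⟩
  refine (grassmannPoints_conj_subset hA hB C hA' hB' ρ hO).antisymm ?_
  have := grassmannPoints_conj_subset hA' hB' C⁻¹ (by rwa [hback]) (by rwa [hback]) ρ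
    (by rw [hback, hback, hO])
  rwa [hback, hback] at this

end QuatHyp

end

open QuatHyp

theorem theorem1p1 (n : ℕ) [NeZero n] (A B A' B' : Sp n)
    (hA : IsSemisimple A) (hB : IsSemisimple B)
    (hA' : IsSemisimple A') (hB' : IsSemisimple B')
    (hAB : ¬ HaveCommonFixedPoint A B) (hAB' : ¬ HaveCommonFixedPoint A' B')
    (ρ : Set (PairType n × Moduli n) → FramePair n) (hρ : IsReference ρ) :
    canonicalOrbit A B ∈ QL n ∧
    (grassmannPoints ρ A B).Nonempty ∧
    (PairConj A B A' B' →
      realTrace A = realTrace A' ∧ realTrace B = realTrace B' ∧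
      canonicalOrbit A B = canonicalOrbit A' B' ∧
      grassmannPoints ρ A B = grassmannPoints ρ A' B') ∧
    (realTrace A = realTrace A' → realTrace B = realTrace B' →
      canonicalOrbit A B = canonicalOrbit A' B' →
      (grassmannPoints ρ A B ∩ grassmannPoints ρ A' B').Nonempty →
      PairConj A B A' B') := by
  exact ⟨canonicalOrbit_mem_QL hA hB hAB, grassmannPoints_nonempty hA hB hAB hρ,
    invariants_eq_of_pairConj hA hB hA' hB' ρ,
    pairConj_of_invariants_eq hA hB hA' hB'⟩
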